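/- **Notation.** For $f\in L^1(\mathbb R^2)$ real-valued let $\mathcal Rf(t,\vartheta)=\int_{\mathbb R} f(t\cos\vartheta-s\sin\vartheta,\,t\sin\vartheta+s\cos\vartheta)\,ds$ be its Radon transform. For functions of one variable let $\mathcal Fg(S)=\int_{\mathbb R} g(t)e^{-itS}\,dt$ and $\mathcal F^{-1}g(t)=\frac1{2\pi}\int_{\mathbb R} g(S)e^{itS}\,dS$ (acting on the first variable $t$, resp. $S$, of functions on $\mathbb R\times[0,\pi)$), and let $\mathcal Bh(x,y)=\frac1\pi\int_0^\pi h(x\cos\vartheta+y\sin\vartheta,\vartheta)\,d\vartheta$ be the back projection. For a window $W:\mathbb R\to\mathbb R$ and $L>0$ put $A_L(S)=|S|\,W(S/L)$, $$f_L=\tfrac12\,\mathcal B\big(\mathcal F^{-1}[A_L(S)\,\mathcal F(\mathcal Rf)(S,\vartheta)]\big),\qquad K_L=\tfrac12\,\mathcal B(\mathcal F^{-1}A_L),$$ and $A=A_1$, $K=K_1$. For $1\le p\le\infty$ let $\omega_p(g,\delta)=\sup_{\|h\|\le\delta}\|g(\cdot-h)-g\|_{L^p(\mathbb R^2)}$.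 For $0<\theta<1$ let $|g|_{B^{\theta,p}_q}=\big(\int_0^\infty (t^{-\theta}\omega_p(g,t))^q\,\frac{dt}t\big)^{1/q}$ if $1\le q<\infty$ and $|g|_{B^{\theta,p}_\infty}=\sup_{t>0}t^{-\theta}\omega_p(g,t)$. For $\alpha=n+\theta$ with $n\in\mathbb N$, $n\ge1$, $0<\theta<1$, let $$|f|_{B^{\alpha,p}_q}=\sum_{j_1+j_2=n}\frac{n!}{j_1!\,j_2!}\,|f^{(j_1,j_2)}|_{B^{\theta,p}_q},$$ where $f^{(j_1,j_2)}$ are weak derivatives (locally integrable functions; the value is $\infty$ if one of them does not exist), and let $B^{\alpha,p}_q(\mathbb R^2)=\{f\in L^p(\mathbb R^2):|f|_{B^{\alpha,p}_q}<\infty\}$. **Theorem.** Let $1\le p,q\le\infty$, $\alpha=n+\theta$ with $n\in\mathbb N$, $n\ge 1$, $0<\theta<1$, and let $f\in L^1(\mathbb R^2)\cap B^{\alpha,p}_q(\mathbb R^2)$. Let $W\in L^\infty(\mathbb R)$ be even and continuous at $0$ with $W(0)=1$, such that $A\in L^1(\mathbb R)\cap L^2(\mathbb R)$, $K\in L^1(\mathbb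 R^2)$, $$\int_{\mathbb R^2}x^{j_1}y^{j_2}K(x,y)\,d(x,y)=0\quad\text{for all }j_1,j_2\in\mathbb N_0\text{ with }1\le j_1+j_2\le n,$$ and $\int_{\mathbb R^2}\|(x,y)\|^\alpha|K(x,y)|\,d(x,y)<\infty$. Then for every $L>0$ we have $f-f_L\in L^p(\mathbb R^2)$ and $$\|f-f_L\|_{L^p(\mathbb R^2)}\le c_{\theta,q}\,\frac{\Gamma(\theta+1)}{\Gamma(\alpha+1)}\Big(\int_{\mathbb R^2}\|(x,y)\|^\alpha|K(x,y)|\,d(x,y)\Big)L^{-\alpha}\,|f|_{B^{\alpha,p}_q},$$ where $c_{\theta,q}=(2e\theta q)^{1/q}$ for $1\le q<\infty$ and $c_{\theta,\infty}=1$. -/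

import Mathlib

open MeasureTheory
open scoped ENNReal

noncomputable section

namespace FBP

/-- The plane with its Euclidean norm. -/
abbrev Plane : Type := EuclideanSpace ℝ (Fin 2)

/-! ### Besov spaces -/

/-- The classical partial derivative in the `i`-th coordinate direction. -/
def partialDeriv (i : Fin 2) (φ : Plane → ℝ) : Plane → ℝ :=
  fun x => fderiv ℝ φ x (EuclideanSpace.single i 1)

/-- The classical mixed derivative `∂₁^{j₁} ∂₂^{j₂} φ`. -/
def mixedDeriv (j : ℕ × ℕ) (φ : Plane → ℝ) : Plane → ℝ :=
  (partialDeriv 0)^[j.1] ((partialDeriv 1)^[j.2] φ)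

/-- `g` is a weak derivative of `f` of multi-index `j`. -/
def IsWeakDeriv (j : ℕ × ℕ) (f g : Plane → ℝ) : Prop :=
  LocallyIntegrable g volume ∧
    ∀ φ : Plane → ℝ, ContDiff ℝ (⊤ : ℕ∞) φ → HasCompactSupport φ →
      ∫ x, f x * mixedDeriv j φ x = (-1) ^ (j.1 + j.2) * ∫ x, g x * φ x

/-- The `L^p`-modulus of continuity `ω_p(f, δ)`. -/
def modulus (p : ℝ≥0∞) (f : Plane → ℝ) (δ : ℝ) : ℝ≥0∞ :=
  ⨆ (h : Plane) (_ : ‖h‖ ≤ δ), eLpNorm (fun x => f (x - h) - f x) p volume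

open Classical in
/-- The Besov semi-norm of order `0 < θ < 1`, with values in `[0, ∞]`. -/
def besovSeminormFrac (θ : ℝ) (p q : ℝ≥0∞) (f : Plane → ℝ) : ℝ≥0∞ :=
  if q = ∞ then
    ⨆ (t : ℝ) (_ : 0 < t), ENNReal.ofReal (t ^ (-θ)) * modulus p f t
  else
    (∫⁻ t in Set.Ioi (0 : ℝ),
      (ENNReal.ofReal (t ^ (-θ)) * modulus p f t) ^ q.toReal * ENNReal.ofReal t⁻¹) ^ (1 / q.toReal)

/-- The Besov semi-norm of order `n + θ` with `0 < θ < 1`: the sum over the multi-indices `j` of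
length `n` of `n! / (j₁! j₂!)` times the semi-norm of order `θ` of the weak derivative `f^{(j)}`.
The infimum runs over the representatives of the (almost everywhere unique) weak derivative; the
semi-norm does not depend on the representative, and the infimum is `∞` if there is no weak
derivative. -/
def besovSeminorm (n : ℕ) (θ : ℝ) (p q : ℝ≥0∞) (f : Plane → ℝ) : ℝ≥0∞ :=
  ∑ j ∈ Finset.HasAntidiagonal.antidiagonal n,
    (n.choose j.1 : ℝ≥0∞) * ⨅ (g : Plane → ℝ) (_ : IsWeakDeriv j f g), besovSeminormFrac θ p q g

/-- Membership in the Besov space `B^{α,p}_q(ℝ²)` with `α = n + θ`, `0 < θ < 1`. -/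
def MemBesov (n : ℕ) (θ : ℝ) (p q : ℝ≥0∞) (f : Plane → ℝ) : Prop :=
  MemLp f p volume ∧ besovSeminorm n θ p q f < ∞

/-! ### Filtered back projection -/

/-- The Radon transform: the integral of `f` with respect to arc length over the line
`{x | x₁ cos ϑ + x₂ sin ϑ = t}`. -/
def radon (f : Plane → ℝ) (t ϑ : ℝ) : ℝ :=
  ∫ s : ℝ, f !₂[t * Real.cos ϑ - s * Real.sin ϑ, t * Real.sin ϑ + s * Real.cos ϑ]

/-- The Fourier transform on `ℝ`, `𝓕 g (S) = ∫ g(t) e^{-itS} dt`. -/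
def fourier (g : ℝ → ℂ) (S : ℝ) : ℂ :=
  ∫ t : ℝ, g t * Complex.exp (-(Complex.I * t * S))

/-- The inverse Fourier transform on `ℝ`, `𝓕⁻¹ g (t) = (2π)⁻¹ ∫ g(S) e^{itS} dS`. -/
def fourierInv (g : ℝ → ℂ) (t : ℝ) : ℂ :=
  (1 / (2 * Real.pi) : ℂ) * ∫ S : ℝ, g S * Complex.exp (Complex.I * t * S)

/-- The back projection operator. -/
def backProj (h : ℝ → ℝ → ℂ) (x : Plane) : ℂ :=
  (1 / Real.pi : ℂ) * ∫ ϑ in (0 : ℝ)..Real.pi, h (x 0 * Real.cos ϑ + x 1 * Real.sin ϑ) ϑ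

/-- The low-pass filter `A_L(S) = |S| W(S / L)` with window `W` and bandwidth `L`. -/
def lowPass (W : ℝ → ℝ) (L S : ℝ) : ℝ :=
  |S| * W (S / L)

/-- The approximate FBP reconstruction `f_L = ½ 𝓑(𝓕⁻¹[A_L(S) 𝓕(𝓡 f)(S, ϑ)])`. -/
def fbp (W : ℝ → ℝ) (L : ℝ) (f : Plane → ℝ) (x : Plane) : ℂ :=
  (1 / 2 : ℂ) * backProj (fun t ϑ =>
    fourierInv (fun S => (lowPass W L S : ℂ) * fourier (fun s => (radon f s ϑ : ℂ)) S) t) x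

/-- The convolution kernel `K_L = ½ 𝓑(𝓕⁻¹ A_L)`; it is real-valued when `W` is even. -/
def kernel (W : ℝ → ℝ) (L : ℝ) (x : Plane) : ℂ :=
  (1 / 2 : ℂ) * backProj (fun t _ => fourierInv (fun S => (lowPass W L S : ℂ)) t) x

open Classical in
/-- The constant `c_{θ,q}`. -/
def besovConst (θ : ℝ) (q : ℝ≥0∞) : ℝ :=
  if q = ∞ then 1 else (2 * Real.exp 1 * θ * q.toReal) ^ (1 / q.toReal)

end FBP

end

/-!
In signed polar coordinates `ξ = S • (cos ϑ, sin ϑ)`, with `S ∈ ℝ` and `0 < ϑ < π`, the plane has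
area element `|S| dS dϑ`, which is exactly the ramp `|S|` of the filter `A_L`. Hence `K_L` is the
inverse Fourier transform on the plane of the function that equals `W(S / L)` in these coordinates,
and the Fourier slice theorem gives `f_L = f ⋆ K_L`. Fourier inversion at the origin gives
`∫ K_L = W(0) = 1`, so `f - f_L` averages `f(x) - f(x - y)` against `K_L(y)`.

For a mollification `F = φ ⋆ f`, subtract the Taylor polynomial of degree `n` of `F` at `x`: the
vanishing moments make this free of charge. The integral form of the remainder involves only
translation differences of the derivatives of order `n`, whose `L^p` norms are at most
`c_{θ,q} ‖h‖^θ` times the Besov semi-norms; Minkowski's inequality and a Beta integral give the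
constant. The bound does not depend on `φ` and passes to the limit, and the scaling
`K_L(x) = L² K(L x)` yields the factor `L^{-α}`.
-/

noncomputable section

open Set Filter Topology
open scoped Real RealInnerProductSpace FourierTransform Convolution

namespace FBP

section Minkowski

variable {X Y : Type*} [MeasurableSpace X] [MeasurableSpace Y] {μ : Measure X} {ν : Measure Y}

/-- Jensen's inequality for the probability measure proportional to `w dν`. -/
theorem rpow_lintegral_le_lintegral_mul_rpow {r : ℝ} (hr : 1 ≤ r) {g w : Y → ℝ≥0∞}
    (hg : AEMeasurable g ν) (hw : AEMeasurable w ν) (hw_top : ∀ᵐ y ∂ν, w y ≠ ∞)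
    (hg_zero : ∀ᵐ y ∂ν, w y = 0 → g y = 0) :
    (∫⁻ y, g y ∂ν) ^ r ≤ (∫⁻ y, w y * (g y / w y) ^ r ∂ν) * (∫⁻ y, w y ∂ν) ^ (r - 1) := by
  have hr0 : 0 < r := one_pos.trans_le hr
  have hdiv : AEMeasurable (fun y => g y / w y) ν := hg.div hw
  have hJensen := eLpNorm'_le_eLpNorm'_mul_rpow_measure_univ one_pos hr
    (hdiv.mono_ac (withDensity_absolutelyContinuous _ w)).aestronglyMeasurable
  simp only [eLpNorm', enorm_eq_self, ENNReal.rpow_one, div_one] at hJensen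
  rw [lintegral_withDensity_eq_lintegral_mul₀ hw hdiv,
    lintegral_withDensity_eq_lintegral_mul₀ hw (hdiv.pow_const r),
    withDensity_apply _ MeasurableSet.univ, Measure.restrict_univ] at hJensen
  simp only [Pi.mul_apply] at hJensen
  have hcancel : ∫⁻ y, w y * (g y / w y) ∂ν = ∫⁻ y, g y ∂ν := by
    refine lintegral_congr_ae ?_
    filter_upwards [hw_top, hg_zero] with y htop hzero
    exact ENNReal.mul_div_cancel' hzero fun h => absurd h htop
  rw [hcancel] at hJensen
  calc (∫⁻ y, g y ∂ν) ^ r ≤ _ := ENNReal.rpow_le_rpow hJensen hr0.le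
    _ = _ := by
      rw [ENNReal.mul_rpow_of_nonneg _ _ hr0.le, ← ENNReal.rpow_mul, ← ENNReal.rpow_mul,
        one_div_mul_cancel hr0.ne', ENNReal.rpow_one]
      congr 2
      field_simp

theorem lintegral_mul_div_rpow_le {r : ℝ} (hr : 0 ≤ r) {g : X → ℝ≥0∞} (hg : Measurable g)
    {c : ℝ≥0∞} (h : ∫⁻ x, g x ^ r ∂μ ≤ c ^ r) : ∫⁻ x, c * (g x / c) ^ r ∂μ ≤ c := by
  simp only [div_eq_mul_inv, ENNReal.mul_rpow_of_nonneg _ _ hr]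
  rw [lintegral_const_mul _ ((hg.pow_const r).mul_const _),
    lintegral_mul_const _ (hg.pow_const r)]
  calc c * ((∫⁻ x, g x ^ r ∂μ) * c⁻¹ ^ r)
    _ ≤ c * (c * c⁻¹) ^ r := by rw [ENNReal.mul_rpow_of_nonneg _ _ hr]; gcongr
    _ ≤ c * 1 := by gcongr; exact ENNReal.rpow_le_one (ENNReal.mul_inv_le_one _) hr
    _ = c := mul_one _

variable [SFinite μ] [SFinite ν]

theorem lintegral_rpow_lintegral_le {r : ℝ} (hr : 1 ≤ r) {F : X → Y → ℝ≥0∞}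
    (hF : Measurable (Function.uncurry F)) {w : Y → ℝ≥0∞} (hw : Measurable w)
    (h : ∀ᵐ y ∂ν, ∫⁻ x, F x y ^ r ∂μ ≤ w y ^ r) :
    ∫⁻ x, (∫⁻ y, F x y ∂ν) ^ r ∂μ ≤ (∫⁻ y, w y ∂ν) ^ r := by
  have hr0 : 0 < r := one_pos.trans_le hr
  set M := ∫⁻ y, w y ∂ν
  rcases eq_or_ne M ∞ with hM_top | hM_top
  · simp [hM_top, hr0]
  have hw_top : ∀ᵐ y ∂ν, w y ≠ ∞ := (ae_lt_top hw hM_top).mono fun _ => LT.lt.ne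
  have hzero : ∀ᵐ x ∂μ, ∀ᵐ y ∂ν, w y = 0 → F x y = 0 := by
    refine (Measure.ae_ae_comm ?_).2 ?_
    · exact ((hw.comp measurable_snd) (measurableSet_singleton 0)).himp
        (hF (measurableSet_singleton 0))
    · filter_upwards [h] with y hy
      rcases eq_or_ne (w y) 0 with hwy | hwy
      · have hint : ∫⁻ x, F x y ^ r ∂μ = 0 := by simpa only [hwy, ENNReal.zero_rpow_of_pos hr0,
          nonpos_iff_eq_zero] using hy
        have hF0 : (fun x => F x y ^ r) =ᵐ[μ] 0 := (lintegral_eq_zero_iff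
          (Measurable.pow_const (hF.comp measurable_prodMk_right) r)).1 hint
        filter_upwards [hF0] with x hx _
        exact (ENNReal.rpow_eq_zero_iff_of_pos hr0).1 hx
      · exact .of_forall fun x h => absurd h hwy
  have hmeas : Measurable (Function.uncurry fun x y => w y * (F x y / w y) ^ r) :=
    (hw.comp measurable_snd).mul ((hF.div (hw.comp measurable_snd)).pow_const r)
  calc ∫⁻ x, (∫⁻ y, F x y ∂ν) ^ r ∂μ
    _ ≤ ∫⁻ x, (∫⁻ y, w y * (F x y / w y) ^ r ∂ν) * M ^ (r - 1) ∂μ := by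
        refine lintegral_mono_ae (hzero.mono fun x hx => ?_)
        exact rpow_lintegral_le_lintegral_mul_rpow hr
          (hF.comp measurable_prodMk_left).aemeasurable hw.aemeasurable hw_top hx
    _ = (∫⁻ y, ∫⁻ x, w y * (F x y / w y) ^ r ∂μ ∂ν) * M ^ (r - 1) := by
        rw [← lintegral_lintegral_swap hmeas.aemeasurable]
        exact lintegral_mul_const _ hmeas.lintegral_prod_right'
    _ ≤ M * M ^ (r - 1) := by
        gcongr ?_ * _
        refine lintegral_mono_ae ?_
        exact h.mono fun y hy =>
          lintegral_mul_div_rpow_le hr0.le (hF.comp measurable_prodMk_right) hy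
    _ = M ^ r := by
        nth_rw 1 [← ENNReal.rpow_one M]
        rw [← ENNReal.rpow_add_of_nonneg _ _ zero_le_one (sub_nonneg.2 hr), add_sub_cancel]

theorem eLpNormEssSup_lintegral_le {F : X → Y → ℝ≥0∞} (hF : Measurable (Function.uncurry F))
    {w : Y → ℝ≥0∞} (hw : Measurable w) (h : ∀ᵐ y ∂ν, eLpNormEssSup (fun x => F x y) μ ≤ w y) :
    eLpNormEssSup (fun x => ∫⁻ y, F x y ∂ν) μ ≤ ∫⁻ y, w y ∂ν := by
  have hle : ∀ᵐ x ∂μ, ∀ᵐ y ∂ν, F x y ≤ w y := by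
    refine (Measure.ae_ae_comm (measurableSet_le (f := fun z : X × Y => F z.1 z.2) hF
      (hw.comp measurable_snd))).2 ?_
    filter_upwards [h] with y hy
    filter_upwards [enorm_ae_le_eLpNormEssSup (fun x => F x y) μ] with x hx
    exact hx.trans hy
  exact eLpNormEssSup_le_of_ae_enorm_bound (hle.mono fun x hx => lintegral_mono_ae hx)

/-- **Minkowski's integral inequality**. The `L^p` norms of the slices are replaced by a majorant
`w` because for `p = ∞` they need not be measurable. -/
theorem eLpNorm_lintegral_le {p : ℝ≥0∞} (hp : 1 ≤ p) {F : X → Y → ℝ≥0∞}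
    (hF : AEMeasurable (Function.uncurry F) (μ.prod ν)) {w : Y → ℝ≥0∞} (hw : AEMeasurable w ν)
    (h : ∀ᵐ y ∂ν, eLpNorm (fun x => F x y) p μ ≤ w y) :
    eLpNorm (fun x => ∫⁻ y, F x y ∂ν) p μ ≤ ∫⁻ y, w y ∂ν := by
  set F' : X → Y → ℝ≥0∞ := Function.curry (hF.mk _)
  have hF'meas : Measurable (Function.uncurry F') := hF.measurable_mk
  have hx : ∀ᵐ x ∂μ, ∀ᵐ y ∂ν, F x y = F' x y := Measure.ae_ae_of_ae_prod hF.ae_eq_mk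
  have hy : ∀ᵐ y ∂ν, ∀ᵐ x ∂μ, F x y = F' x y :=
    Measure.ae_ae_of_ae_prod (Measure.measurePreserving_swap.quasiMeasurePreserving.ae hF.ae_eq_mk)
  have h' : ∀ᵐ y ∂ν, eLpNorm (fun x => F' x y) p μ ≤ hw.mk w y := by
    filter_upwards [h, hy, hw.ae_eq_mk] with y hle hFy hwy
    rwa [← hwy, ← eLpNorm_congr_ae hFy]
  rw [eLpNorm_congr_ae (hx.mono fun x hFx => lintegral_congr_ae hFx),
    lintegral_congr_ae hw.ae_eq_mk]
  rcases eq_or_ne p ∞ with rfl | hp_top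
  · exact eLpNormEssSup_lintegral_le hF'meas hw.measurable_mk h'
  have hp0 : p ≠ 0 := (one_pos.trans_le hp).ne'
  have hr : 1 ≤ p.toReal := by simpa using ENNReal.toReal_mono hp_top hp
  simp only [eLpNorm_eq_lintegral_rpow_enorm_toReal hp0 hp_top, one_div,
    ENNReal.rpow_inv_le_iff (one_pos.trans_le hr), enorm_eq_self] at h' ⊢
  exact lintegral_rpow_lintegral_le hr hF'meas hw.measurable_mk h'

theorem eLpNorm_integral_le {E : Type*} [NormedAddCommGroup E] [NormedSpace ℝ E] {p : ℝ≥0∞}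
    (hp : 1 ≤ p) {F : X → Y → E} (hF : AEStronglyMeasurable (Function.uncurry F) (μ.prod ν))
    {w : Y → ℝ≥0∞} (hw : AEMeasurable w ν) (h : ∀ᵐ y ∂ν, eLpNorm (fun x => F x y) p μ ≤ w y) :
    eLpNorm (fun x => ∫ y, F x y ∂ν) p μ ≤ ∫⁻ y, w y ∂ν :=
  calc eLpNorm (fun x => ∫ y, F x y ∂ν) p μ
    _ ≤ eLpNorm (fun x => ∫⁻ y, ‖F x y‖ₑ ∂ν) p μ :=
      eLpNorm_mono_enorm fun x => by
        simpa only [enorm_eq_self] using enorm_integral_le_lintegral_enorm (F x)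
    _ ≤ ∫⁻ y, w y ∂ν :=
      eLpNorm_lintegral_le hp hF.enorm hw (h.mono fun y hy => (eLpNorm_enorm _).trans_le hy)

/-- **Young's convolution inequality** for an integrable factor. -/
theorem eLpNorm_convolution_le {G E : Type*} [AddGroup G] [MeasurableSpace G] [MeasurableAdd₂ G]
    [MeasurableNeg G] {μ : Measure G} [SFinite μ] [μ.IsAddLeftInvariant] [μ.IsAddRightInvariant]
    [NormedAddCommGroup E] [NormedSpace ℝ E] {p : ℝ≥0∞} (hp : 1 ≤ p) {φ : G → ℝ} {g : G → E}
    (hφ : AEStronglyMeasurable φ μ) (hg : AEStronglyMeasurable g μ) :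
    eLpNorm (φ ⋆[ContinuousLinearMap.lsmul ℝ ℝ, μ] g) p μ ≤ eLpNorm φ 1 μ * eLpNorm g p μ := by
  have hmeas : AEStronglyMeasurable (fun z : G × G => φ z.2 • g (z.1 - z.2)) (μ.prod μ) :=
    hφ.comp_snd.smul (hg.comp_quasiMeasurePreserving (quasiMeasurePreserving_sub μ μ))
  have hslice : ∀ y, eLpNorm (fun x => φ y • g (x - y)) p μ = ‖φ y‖ₑ * eLpNorm g p μ := fun y =>
    (eLpNorm_const_smul (φ y) (fun x => g (x - y)) p μ).trans
      (congrArg _ (eLpNorm_comp_measurePreserving hg (measurePreserving_sub_right μ y)))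
  calc eLpNorm (φ ⋆[ContinuousLinearMap.lsmul ℝ ℝ, μ] g) p μ
    _ ≤ ∫⁻ y, ‖φ y‖ₑ * eLpNorm g p μ ∂μ :=
      eLpNorm_integral_le hp hmeas (hφ.enorm.mul_const _) (ae_of_all _ fun y => (hslice y).le)
    _ = eLpNorm φ 1 μ * eLpNorm g p μ := by
      rw [lintegral_mul_const'' _ hφ.enorm, eLpNorm_one_eq_lintegral_enorm]

end Minkowski

section Besov

theorem monotone_modulus (p : ℝ≥0∞) (g : Plane → ℝ) : Monotone (modulus p g) := fun _ _ hst =>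
  iSup_mono fun _ => iSup_mono' fun hs => ⟨hs.trans hst, le_rfl⟩

theorem eLpNorm_translate_sub_le_modulus (p : ℝ≥0∞) (g : Plane → ℝ) (h : Plane) :
    eLpNorm (fun x => g (x - h) - g x) p volume ≤ modulus p g ‖h‖ :=
  le_iSup₂_of_le h le_rfl le_rfl

theorem besovConst_pos {θ : ℝ} (hθ : 0 < θ) {q : ℝ≥0∞} (hq : q ≠ 0) : 0 < besovConst θ q := by
  unfold besovConst
  split_ifs with hq_top
  · exact zero_lt_one
  · have := ENNReal.toReal_pos hq hq_top
    positivity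

theorem rpow_toReal_besovConst {θ : ℝ} (hθ : 0 ≤ θ) {q : ℝ≥0∞} (hq : q ≠ 0) (hq_top : q ≠ ∞) :
    besovConst θ q ^ q.toReal = 2 * Real.exp 1 * θ * q.toReal := by
  rw [besovConst, if_neg hq_top, ← Real.rpow_mul (by positivity),
    one_div_mul_cancel (ENNReal.toReal_pos hq hq_top).ne', Real.rpow_one]

theorem lintegral_Ioi_rpow {a t : ℝ} (ha : a < -1) (ht : 0 < t) :
    ∫⁻ s in Ioi t, ENNReal.ofReal (s ^ a) = ENNReal.ofReal (-t ^ (a + 1) / (a + 1)) := by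
  rw [← integral_Ioi_rpow_of_lt ha ht,
    ofReal_integral_eq_lintegral_ofReal (integrableOn_Ioi_rpow_of_lt ha ht)]
  filter_upwards [ae_restrict_mem measurableSet_Ioi] with s hs
  exact Real.rpow_nonneg (ht.trans hs).le _

theorem rpow_le_lintegral_of_monotone {ω : ℝ → ℝ≥0∞} (hω : Monotone ω) {θ r t : ℝ} (hθ : 0 < θ)
    (hr : 0 < r) (ht : 0 < t) :
    ω t ^ r ≤ ENNReal.ofReal (θ * r * t ^ (θ * r)) *
      ∫⁻ s in Ioi (0 : ℝ), (ENNReal.ofReal (s ^ (-θ)) * ω s) ^ r * ENNReal.ofReal s⁻¹ := by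
  have htail : ENNReal.ofReal (t ^ (-(θ * r)) / (θ * r)) * ω t ^ r ≤
      ∫⁻ s in Ioi (0 : ℝ), (ENNReal.ofReal (s ^ (-θ)) * ω s) ^ r * ENNReal.ofReal s⁻¹ :=
    calc ENNReal.ofReal (t ^ (-(θ * r)) / (θ * r)) * ω t ^ r
      _ = ∫⁻ s in Ioi t, ENNReal.ofReal (s ^ (-(θ * r) - 1)) * ω t ^ r := by
        rw [lintegral_mul_const _ (by fun_prop),
          lintegral_Ioi_rpow (by linarith [mul_pos hθ hr]) ht, sub_add_cancel, neg_div_neg_eq]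
      _ ≤ ∫⁻ s in Ioi t, (ENNReal.ofReal (s ^ (-θ)) * ω s) ^ r * ENNReal.ofReal s⁻¹ := by
        refine setLIntegral_mono' measurableSet_Ioi fun s hs => ?_
        have hs0 : 0 < s := ht.trans hs
        have hpow : s ^ (-(θ * r) - 1) = (s ^ (-θ)) ^ r * s⁻¹ := by
          rw [Real.rpow_sub_one hs0.ne', ← Real.rpow_mul hs0.le, neg_mul, div_eq_mul_inv]
        rw [hpow, ENNReal.ofReal_mul (by positivity), ENNReal.mul_rpow_of_nonneg _ _ hr.le,
          ENNReal.ofReal_rpow_of_nonneg (by positivity) hr.le, mul_right_comm]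
        gcongr
        exact hω (le_of_lt hs)
      _ ≤ _ := lintegral_mono_set (Ioi_subset_Ioi ht.le)
  have hinv : θ * r * t ^ (θ * r) * (t ^ (-(θ * r)) / (θ * r)) = 1 := by
    rw [Real.rpow_neg ht.le]
    field_simp
  calc ω t ^ r
    _ = ENNReal.ofReal (θ * r * t ^ (θ * r)) *
        (ENNReal.ofReal (t ^ (-(θ * r)) / (θ * r)) * ω t ^ r) := by
      rw [← mul_assoc, ← ENNReal.ofReal_mul (by positivity), hinv, ENNReal.ofReal_one, one_mul]
    _ ≤ _ := by gcongr

theorem modulus_le_besovSeminormFrac {θ : ℝ} (hθ : 0 < θ) {p q : ℝ≥0∞} (hq : q ≠ 0)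
    (g : Plane → ℝ) {t : ℝ} (ht : 0 < t) :
    modulus p g t ≤ ENNReal.ofReal (besovConst θ q * t ^ θ) * besovSeminormFrac θ p q g := by
  rcases eq_or_ne q ∞ with rfl | hq_top
  · simp only [besovConst, besovSeminormFrac, if_true, one_mul]
    calc modulus p g t
      _ = ENNReal.ofReal (t ^ θ) * (ENNReal.ofReal (t ^ (-θ)) * modulus p g t) := by
        rw [← mul_assoc, ← ENNReal.ofReal_mul (by positivity), ← Real.rpow_add ht,
          add_neg_cancel, Real.rpow_zero, ENNReal.ofReal_one, one_mul]
      _ ≤ _ := by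
        gcongr
        exact le_iSup₂ (f := fun (s : ℝ) (_ : 0 < s) =>
          ENNReal.ofReal (s ^ (-θ)) * modulus p g s) t ht
  · have hr : 0 < q.toReal := ENNReal.toReal_pos hq hq_top
    have hc := (besovConst_pos hθ hq).le
    rw [besovSeminormFrac, if_neg hq_top, ← ENNReal.rpow_le_rpow_iff hr,
      ENNReal.mul_rpow_of_nonneg _ _ hr.le, ← ENNReal.rpow_mul, one_div_mul_cancel hr.ne',
      ENNReal.rpow_one, ENNReal.ofReal_rpow_of_nonneg (by positivity) hr.le,
      Real.mul_rpow hc (by positivity), rpow_toReal_besovConst hθ.le hq hq_top,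
      ← Real.rpow_mul ht.le]
    refine (rpow_le_lintegral_of_monotone (monotone_modulus p g) hθ hr ht).trans ?_
    gcongr
    nlinarith [Real.add_one_le_exp 1, mul_pos hθ hr]

end Besov

section MixedDeriv

variable {φ : Plane → ℝ}

theorem contDiff_iterate_partialDeriv (hφ : ContDiff ℝ (⊤ : ℕ∞) φ) (i : Fin 2) (k : ℕ) :
    ContDiff ℝ (⊤ : ℕ∞) ((partialDeriv i)^[k] φ) :=
  Function.Iterate.rec (ContDiff ℝ (⊤ : ℕ∞)) hφ
    (fun _ hψ => (hψ.fderiv_right (by simp)).clm_apply contDiff_const) k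

theorem contDiff_mixedDeriv (hφ : ContDiff ℝ (⊤ : ℕ∞) φ) (j : ℕ × ℕ) :
    ContDiff ℝ (⊤ : ℕ∞) (mixedDeriv j φ) :=
  contDiff_iterate_partialDeriv (contDiff_iterate_partialDeriv hφ 1 j.2) 0 j.1

theorem hasCompactSupport_iterate_partialDeriv (hφ : HasCompactSupport φ) (i : Fin 2) (k : ℕ) :
    HasCompactSupport ((partialDeriv i)^[k] φ) :=
  Function.Iterate.rec HasCompactSupport hφ
    (fun _ (hψ : HasCompactSupport _) => hψ.fderiv_apply ℝ _) k

theorem fderiv_apply_eq_partialDeriv (φ : Plane → ℝ) (x y : Plane) :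
    fderiv ℝ φ x y = y 0 * partialDeriv 0 φ x + y 1 * partialDeriv 1 φ x := by
  have hy : y = y 0 • EuclideanSpace.single (0 : Fin 2) (1 : ℝ) +
      y 1 • EuclideanSpace.single (1 : Fin 2) (1 : ℝ) := by
    ext i
    fin_cases i <;> simp
  conv_lhs => rw [hy]
  rw [map_add, map_smul, map_smul]
  rfl

theorem partialDeriv_comm (hφ : ContDiff ℝ 2 φ) (i j : Fin 2) :
    partialDeriv i (partialDeriv j φ) = partialDeriv j (partialDeriv i φ) := by
  have hdiff : Differentiable ℝ (fderiv ℝ φ) :=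
    (hφ.fderiv_right (m := 1) one_add_one_eq_two.le).differentiable one_ne_zero
  have hsecond : ∀ x v w : Plane,
      fderiv ℝ (fun z => fderiv ℝ φ z v) x w = fderiv ℝ (fderiv ℝ φ) x w v := fun x v w => by
    rw [fderiv_clm_apply (hdiff x) (differentiableAt_const v)]
    simp
  ext x
  unfold partialDeriv
  rw [hsecond, hsecond]
  exact hφ.contDiffAt.isSymmSndFDerivAt (by simp) _ _

theorem partialDeriv_iterate_partialDeriv_comm (hφ : ContDiff ℝ (⊤ : ℕ∞) φ) (i j : Fin 2)
    (k : ℕ) :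
    partialDeriv i ((partialDeriv j)^[k] φ) = (partialDeriv j)^[k] (partialDeriv i φ) := by
  induction k with
  | zero => rfl
  | succ k ih =>
    have hk : ContDiff ℝ 2 ((partialDeriv j)^[k] φ) :=
      (contDiff_iterate_partialDeriv hφ j k).of_le (WithTop.coe_le_coe.2 le_top)
    rw [Function.iterate_succ_apply', partialDeriv_comm hk, ih, Function.iterate_succ_apply']

theorem partialDeriv_zero_mixedDeriv (φ : Plane → ℝ) (a b : ℕ) :
    partialDeriv 0 (mixedDeriv (a, b) φ) = mixedDeriv (a + 1, b) φ := by
  simp only [mixedDeriv, Function.iterate_succ_apply']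

theorem partialDeriv_one_mixedDeriv (hφ : ContDiff ℝ (⊤ : ℕ∞) φ) (a b : ℕ) :
    partialDeriv 1 (mixedDeriv (a, b) φ) = mixedDeriv (a, b + 1) φ := by
  simp only [mixedDeriv,
    partialDeriv_iterate_partialDeriv_comm (contDiff_iterate_partialDeriv hφ 1 b),
    Function.iterate_succ_apply']

theorem iteratedFDeriv_apply_eq_sum_mixedDeriv (hφ : ContDiff ℝ (⊤ : ℕ∞) φ) (k : ℕ)
    (x y : Plane) : iteratedFDeriv ℝ k φ x (fun _ => y) =
      ∑ j ∈ Finset.HasAntidiagonal.antidiagonal k,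
        (k.choose j.1 : ℝ) * (y 0 ^ j.1 * y 1 ^ j.2 * mixedDeriv j φ x) := by
  induction k generalizing x with
  | zero => simp [mixedDeriv]
  | succ k ih =>
    have hdiff : DifferentiableAt ℝ (iteratedFDeriv ℝ k φ) x :=
      hφ.differentiable_iteratedFDeriv (m := k) (by exact_mod_cast ENat.natCast_lt_top k) x
    have hmixed : ∀ j, DifferentiableAt ℝ (mixedDeriv j φ) x := fun j =>
      (contDiff_mixedDeriv hφ j).differentiable (by simp) x
    have hih : (fun z => iteratedFDeriv ℝ k φ z (Fin.tail fun _ : Fin (k + 1) => y)) =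
        fun z => ∑ j ∈ Finset.HasAntidiagonal.antidiagonal k,
          (k.choose j.1 : ℝ) * (y 0 ^ j.1 * y 1 ^ j.2 * mixedDeriv j φ z) := funext ih
    rw [hdiff.iteratedFDeriv_succ_apply_left', hih,
      fderiv_fun_sum fun j _ => ((hmixed j).const_mul _).const_mul _, sum_apply,
      Finset.sum_antidiagonal_choose_succ_mul
        (fun a b => y 0 ^ a * y 1 ^ b * mixedDeriv (a, b) φ x), ← Finset.sum_add_distrib]
    refine Finset.sum_congr rfl fun ⟨a, b⟩ hj => ?_
    have hchoose : k.choose b = k.choose a := Nat.choose_symm_of_eq_add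
      (by rw [← Finset.HasAntidiagonal.mem_antidiagonal.1 hj, add_comm])
    rw [fderiv_const_mul ((hmixed _).const_mul _), fderiv_const_mul (hmixed _)]
    simp only [smul_apply, smul_eq_mul, fderiv_apply_eq_partialDeriv, hchoose,
      partialDeriv_zero_mixedDeriv, partialDeriv_one_mixedDeriv hφ]
    ring

theorem partialDeriv_const_mul_comp_const_sub (hφ : Differentiable ℝ φ) (i : Fin 2) (c : ℝ)
    (x : Plane) : partialDeriv i (fun y => c * φ (x - y)) =
      fun y => -c * partialDeriv i φ (x - y) := by
  ext y
  have hcomp := ((hφ (x - y)).hasFDerivAt.comp y ((hasFDerivAt_id y).const_sub x)).const_mul c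
  simp only [partialDeriv]
  rw [HasFDerivAt.fderiv (f := fun z => c * φ (x - z)) hcomp]
  simp

theorem iterate_partialDeriv_const_mul_comp_const_sub (hφ : ContDiff ℝ (⊤ : ℕ∞) φ) (i : Fin 2)
    (k : ℕ) (c : ℝ) (x : Plane) : (partialDeriv i)^[k] (fun y => c * φ (x - y)) =
      fun y => (-1) ^ k * c * (partialDeriv i)^[k] φ (x - y) := by
  induction k with
  | zero => simp
  | succ k ih =>
    rw [Function.iterate_succ_apply', Function.iterate_succ_apply', ih,
      partialDeriv_const_mul_comp_const_sub
        ((contDiff_iterate_partialDeriv hφ i k).differentiable (by simp)), pow_succ']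
    simp only [neg_mul, one_mul]

theorem mixedDeriv_comp_const_sub (hφ : ContDiff ℝ (⊤ : ℕ∞) φ) (j : ℕ × ℕ) (x : Plane) :
    mixedDeriv j (fun y => φ (x - y)) =
      fun y => (-1) ^ (j.1 + j.2) * mixedDeriv j φ (x - y) := by
  have hone := iterate_partialDeriv_const_mul_comp_const_sub hφ 1 j.2 1 x
  simp only [one_mul, mul_one] at hone
  unfold mixedDeriv
  rw [hone, iterate_partialDeriv_const_mul_comp_const_sub
    (contDiff_iterate_partialDeriv hφ 1 j.2), pow_add]

end MixedDeriv

section Mollification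

variable {φ f g : Plane → ℝ}

theorem partialDeriv_convolution (hφ : ContDiff ℝ (⊤ : ℕ∞) φ) (hc : HasCompactSupport φ)
    (hf : LocallyIntegrable f volume) (i : Fin 2) :
    partialDeriv i (φ ⋆ f) = partialDeriv i φ ⋆ f := by
  ext x
  have hφ₁ : ContDiff ℝ 1 φ := hφ.of_le (by exact_mod_cast le_top)
  unfold partialDeriv
  rw [← convolution_flip,
    (hc.hasFDerivAt_convolution_right (ContinuousLinearMap.lsmul ℝ ℝ).flip hf hφ₁ x).fderiv,
    convolution_precompR_apply _ hf (hc.fderiv ℝ) (hφ₁.continuous_fderiv one_ne_zero),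
    convolution_flip]

theorem iterate_partialDeriv_convolution (hφ : ContDiff ℝ (⊤ : ℕ∞) φ) (hc : HasCompactSupport φ)
    (hf : LocallyIntegrable f volume) (i : Fin 2) (k : ℕ) :
    (partialDeriv i)^[k] (φ ⋆ f) = (partialDeriv i)^[k] φ ⋆ f := by
  induction k with
  | zero => rfl
  | succ k ih =>
    rw [Function.iterate_succ_apply', Function.iterate_succ_apply', ih,
      partialDeriv_convolution (contDiff_iterate_partialDeriv hφ i k)
        (hasCompactSupport_iterate_partialDeriv hc i k) hf]

theorem mixedDeriv_convolution (hφ : ContDiff ℝ (⊤ : ℕ∞) φ) (hc : HasCompactSupport φ)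
    (hf : LocallyIntegrable f volume) (j : ℕ × ℕ) :
    mixedDeriv j (φ ⋆ f) = mixedDeriv j φ ⋆ f := by
  unfold mixedDeriv
  rw [iterate_partialDeriv_convolution hφ hc hf,
    iterate_partialDeriv_convolution (contDiff_iterate_partialDeriv hφ 1 j.2)
      (hasCompactSupport_iterate_partialDeriv hc 1 j.2) hf]

theorem IsWeakDeriv.mixedDeriv_convolution {j : ℕ × ℕ} (h : IsWeakDeriv j f g)
    (hφ : ContDiff ℝ (⊤ : ℕ∞) φ) (hc : HasCompactSupport φ) (hf : LocallyIntegrable f volume) :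
    mixedDeriv j (φ ⋆ f) = φ ⋆ g := by
  ext x
  have hweak := h.2 (fun y => φ (x - y)) (hφ.comp (contDiff_const.sub contDiff_id))
    (hc.comp_homeomorph (Homeomorph.subLeft x))
  simp only [mixedDeriv_comp_const_sub hφ, mul_left_comm (f _), integral_const_mul] at hweak
  rw [FBP.mixedDeriv_convolution hφ hc hf, convolution_eq_swap, convolution_eq_swap]
  simp only [ContinuousLinearMap.lsmul_apply, smul_eq_mul, mul_comm _ (f _), mul_comm _ (g _)]
  exact mul_left_cancel₀ (pow_ne_zero _ (by norm_num)) hweak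

theorem convolution_translate_sub (hφ : Continuous φ) (hc : HasCompactSupport φ)
    (hg : LocallyIntegrable g volume) (h x : Plane) :
    (φ ⋆ g) (x - h) - (φ ⋆ g) x = (φ ⋆ fun y => g (y - h) - g y) x := by
  have hconv : ConvolutionExists φ g (ContinuousLinearMap.lsmul ℝ ℝ) volume :=
    hc.convolutionExists_left _ hφ hg
  rw [convolution, convolution, convolution, ← integral_sub (hconv _) (hconv _)]
  simp only [map_sub, sub_right_comm]

theorem eLpNorm_translate_sub_le_besovSeminormFrac {θ : ℝ} (hθ : 0 < θ) {p q : ℝ≥0∞}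
    (hq : q ≠ 0) (g : Plane → ℝ) (h : Plane) :
    eLpNorm (fun x => g (x - h) - g x) p volume ≤
      ENNReal.ofReal (besovConst θ q * ‖h‖ ^ θ) * besovSeminormFrac θ p q g := by
  rcases eq_or_ne h 0 with rfl | hh
  · simp
  · exact (eLpNorm_translate_sub_le_modulus p g h).trans
      (modulus_le_besovSeminormFrac hθ hq g (norm_pos_iff.2 hh))

theorem eLpNorm_translate_sub_convolution_le {θ : ℝ} (hθ : 0 < θ) {p q : ℝ≥0∞} (hp : 1 ≤ p)
    (hq : q ≠ 0) (hφ : Continuous φ) (hc : HasCompactSupport φ) (hg : LocallyIntegrable g volume)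
    (h : Plane) :
    eLpNorm (fun x => (φ ⋆ g) (x - h) - (φ ⋆ g) x) p volume ≤ eLpNorm φ 1 volume *
      (ENNReal.ofReal (besovConst θ q * ‖h‖ ^ θ) * besovSeminormFrac θ p q g) := by
  have hdiff : AEStronglyMeasurable (fun x => g (x - h) - g x) volume :=
    (hg.aestronglyMeasurable.comp_measurePreserving (measurePreserving_sub_right volume h)).sub
      hg.aestronglyMeasurable
  simp only [convolution_translate_sub hφ hc hg]
  exact (eLpNorm_convolution_le hp hφ.aestronglyMeasurable hdiff).trans
    (by gcongr; exact eLpNorm_translate_sub_le_besovSeminormFrac hθ hq g h)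

end Mollification

section Taylor

theorem lintegral_Ioc_one_sub_pow_mul_rpow (n : ℕ) {θ : ℝ} (hθ : -1 < θ) :
    ∫⁻ t in Ioc (0 : ℝ) 1, ENNReal.ofReal ((1 - t) ^ n * t ^ θ) =
      ENNReal.ofReal (n.factorial * (Real.Gamma (θ + 1) / Real.Gamma (n + 1 + θ + 1))) := by
  have hbeta : 0 < ProbabilityTheory.beta (θ + 1) (n + 1) :=
    ProbabilityTheory.beta_pos (by linarith) (by positivity)
  have hone := ProbabilityTheory.lintegral_betaPDF_eq_one (α := θ + 1) (β := n + 1)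
    (by linarith) (by positivity)
  simp only [ProbabilityTheory.lintegral_betaPDF, add_sub_cancel_right, Real.rpow_natCast,
    mul_assoc, mul_comm (_ ^ θ)] at hone
  have hB : ENNReal.ofReal (1 / ProbabilityTheory.beta (θ + 1) (n + 1)) *
      ∫⁻ t in Ioo (0 : ℝ) 1, ENNReal.ofReal ((1 - t) ^ n * t ^ θ) = 1 := by
    rw [← lintegral_const_mul _ (by fun_prop), ← hone]
    exact lintegral_congr fun t => (ENNReal.ofReal_mul (by positivity)).symm
  rw [setLIntegral_congr Ioo_ae_eq_Ioc.symm]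
  calc ∫⁻ t in Ioo (0 : ℝ) 1, ENNReal.ofReal ((1 - t) ^ n * t ^ θ)
    _ = ENNReal.ofReal (ProbabilityTheory.beta (θ + 1) (n + 1)) := by
      rw [one_div, ENNReal.ofReal_inv_of_pos hbeta, mul_comm] at hB
      rw [ENNReal.eq_inv_of_mul_eq_one_left hB, inv_inv]
    _ = _ := by
      rw [ProbabilityTheory.beta, Real.Gamma_nat_eq_factorial]
      congr 1
      ring_nf

theorem Gamma_div_Gamma_nonneg (n : ℕ) {θ : ℝ} (hθ : 0 ≤ θ) :
    0 ≤ Real.Gamma (θ + 1) / Real.Gamma (n + θ + 1) :=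
  div_nonneg (Real.Gamma_nonneg_of_nonneg (by positivity))
    (Real.Gamma_nonneg_of_nonneg (by positivity))

theorem pow_le_one_add_rpow {m n : ℕ} (hmn : m ≤ n) {θ : ℝ} (hθ : 0 ≤ θ) {r : ℝ} (hr : 0 ≤ r) :
    r ^ m ≤ 1 + r ^ (n + θ) := by
  have hpow : 0 ≤ r ^ (n + θ) := Real.rpow_nonneg hr _
  rcases le_total r 1 with hr₁ | hr₁
  · linarith [pow_le_one₀ (n := m) hr hr₁]
  · have hexp : (m : ℝ) ≤ n + θ := by
      have : (m : ℝ) ≤ n := by exact_mod_cast hmn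
      linarith
    rw [← Real.rpow_natCast]
    linarith [Real.rpow_le_rpow_of_exponent_le hr₁ hexp]

theorem integrable_smul_of_norm_le_mul_pow {E G : Type*} [NormedAddCommGroup E]
    [MeasurableSpace E] [OpensMeasurableSpace E] [NormedAddCommGroup G] [NormedSpace ℝ G]
    {μ : Measure E} {k : E → G} {m n : ℕ} (hmn : m ≤ n) {θ : ℝ} (hθ : 0 ≤ θ)
    (hk : Integrable k μ) (hkα : Integrable (fun y => ‖y‖ ^ (n + θ) * ‖k y‖) μ) {P : E → ℝ}
    (hP : Continuous P) {C : ℝ} (hC : 0 ≤ C) (hPC : ∀ y, ‖P y‖ ≤ C * ‖y‖ ^ m) :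
    Integrable (fun y => P y • k y) μ := by
  refine ((hk.norm.add hkα).const_mul C).mono' (hP.aestronglyMeasurable.smul hk.1)
    (.of_forall fun y => ?_)
  calc ‖P y • k y‖
    _ ≤ C * ‖y‖ ^ m * ‖k y‖ := by
      rw [norm_smul]
      gcongr
      exact hPC y
    _ ≤ C * (1 + ‖y‖ ^ (n + θ)) * ‖k y‖ := by
      gcongr
      exact pow_le_one_add_rpow hmn hθ (norm_nonneg y)
    _ = C * (‖k y‖ + ‖y‖ ^ (n + θ) * ‖k y‖) := by ring

variable {E G : Type*} [NormedAddCommGroup E] [NormedSpace ℝ E] [NormedAddCommGroup G]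
  [NormedSpace ℝ G] {n : ℕ} {F : E → G}

/-- The Taylor polynomial of degree `n` of `F` at `x`, in the increment `v`. -/
def taylorPoly (n : ℕ) (F : E → G) (x v : E) : G :=
  ∑ m ∈ Finset.range (n + 1), (m.factorial : ℝ)⁻¹ • iteratedFDeriv ℝ m F x fun _ => v

theorem continuous_taylorPoly (hF : ContDiff ℝ n F) :
    Continuous fun z : E × E => taylorPoly n F z.1 z.2 := by
  unfold taylorPoly
  refine continuous_finsetSum _ fun m hm => ?_
  have hm : Continuous (iteratedFDeriv ℝ m F) :=
    hF.continuous_iteratedFDeriv (by exact_mod_cast Finset.mem_range_succ_iff.1 hm)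
  fun_prop

theorem map_add_sub_taylorPoly [CompleteSpace G] (hF : ContDiff ℝ (n + 1 : ℕ) F) (x v : E) :
    F (x + v) - taylorPoly (n + 1) F x v = (n.factorial : ℝ)⁻¹ • ∫ t in (0 : ℝ)..1, (1 - t) ^ n •
      (iteratedFDeriv ℝ (n + 1) F (x + t • v) (fun _ => v) -
        iteratedFDeriv ℝ (n + 1) F x fun _ => v) := by
  have : Continuous (iteratedFDeriv ℝ (n + 1) F) := hF.continuous_iteratedFDeriv le_rfl
  have hTaylor := map_add_eq_sum_add_integral_iteratedFDeriv (f := F) (x := x) (y := v) (n := n)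
    fun _ _ => hF.contDiffAt
  have hweight : ∫ t in (0 : ℝ)..1, (1 - t) ^ n = ((n : ℝ) + 1)⁻¹ := by
    rw [intervalIntegral.integral_comp_sub_left (fun t => t ^ n) 1]
    simp
  simp only [smul_sub]
  rw [taylorPoly, Finset.sum_range_succ, ← sub_sub, hTaylor, add_sub_cancel_left,
    intervalIntegral.integral_sub, intervalIntegral.integral_smul_const, hweight, smul_sub,
    smul_smul, Nat.factorial_succ, Nat.cast_mul, mul_inv, mul_comm (n.factorial : ℝ)⁻¹,
    Nat.cast_succ]
  · exact Continuous.intervalIntegrable (by fun_prop) _ _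
  · exact Continuous.intervalIntegrable (by fun_prop) _ _

section Remainder

variable [CompleteSpace G] [SecondCountableTopology E] [MeasurableSpace E] [BorelSpace E]
  {μ : Measure E} [SFinite μ] {p : ℝ≥0∞} {θ : ℝ} {B : ℝ≥0∞}

theorem eLpNorm_map_add_sub_taylorPoly_le (hp : 1 ≤ p) (hθ : 0 ≤ θ) (hF : ContDiff ℝ n F)
    (hB : ∀ h v, eLpNorm (fun x => iteratedFDeriv ℝ n F (x + h) (fun _ => v) -
      iteratedFDeriv ℝ n F x fun _ => v) p μ ≤ B * ENNReal.ofReal (‖h‖ ^ θ * ‖v‖ ^ n)) (v : E) :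
    eLpNorm (fun x => F (x + v) - taylorPoly n F x v) p μ ≤
      B * ENNReal.ofReal (Real.Gamma (θ + 1) / Real.Gamma (n + θ + 1) * ‖v‖ ^ (n + θ)) := by
  cases n with
  | zero =>
    have hΓ : Real.Gamma (θ + 1) ≠ 0 := (Real.Gamma_pos_of_pos (by linarith)).ne'
    simpa [taylorPoly, hΓ] using hB v v
  | succ n =>
    have : Continuous (iteratedFDeriv ℝ (n + 1) F) := hF.continuous_iteratedFDeriv le_rfl
    have hscaled : ∀ t ∈ Ioc (0 : ℝ) 1, eLpNorm (fun x => (1 - t) ^ n •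
        (iteratedFDeriv ℝ (n + 1) F (x + t • v) (fun _ => v) -
          iteratedFDeriv ℝ (n + 1) F x fun _ => v)) p μ ≤
        B * ENNReal.ofReal (‖v‖ ^ ((n + 1 : ℕ) + θ)) * ENNReal.ofReal ((1 - t) ^ n * t ^ θ) := by
      intro t ht
      have hweight : 0 ≤ (1 - t) ^ n := pow_nonneg (sub_nonneg.2 ht.2) n
      refine (eLpNorm_const_smul_le ..).trans ((mul_le_mul_right (hB (t • v) v) _).trans_eq ?_)
      rw [norm_smul, Real.norm_of_nonneg ht.1.le, Real.mul_rpow ht.1.le (norm_nonneg v),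
        Real.rpow_add_of_nonneg (norm_nonneg v) (by positivity) hθ, Real.rpow_natCast,
        Real.enorm_of_nonneg hweight, mul_left_comm, ← ENNReal.ofReal_mul hweight,
        mul_assoc B, ← ENNReal.ofReal_mul (by positivity)]
      congr 2
      ring
    have hmeas : AEStronglyMeasurable (fun z : E × ℝ => (1 - z.2) ^ n •
        (iteratedFDeriv ℝ (n + 1) F (z.1 + z.2 • v) (fun _ => v) -
          iteratedFDeriv ℝ (n + 1) F z.1 fun _ => v)) (μ.prod (volume.restrict (Ioc 0 1))) :=
      Continuous.aestronglyMeasurable (by fun_prop)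
    simp only [map_add_sub_taylorPoly hF, intervalIntegral.integral_of_le zero_le_one]
    calc _ ≤ ‖(n.factorial : ℝ)⁻¹‖ₑ * ∫⁻ t in Ioc (0 : ℝ) 1, B *
          ENNReal.ofReal (‖v‖ ^ ((n + 1 : ℕ) + θ)) * ENNReal.ofReal ((1 - t) ^ n * t ^ θ) :=
        (eLpNorm_const_smul_le ..).trans (mul_le_mul_right (eLpNorm_integral_le hp hmeas
          (by fun_prop) ((ae_restrict_mem measurableSet_Ioc).mono hscaled)) _)
      _ = _ := by
        rw [lintegral_const_mul _ (by fun_prop),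
          lintegral_Ioc_one_sub_pow_mul_rpow n (by linarith), Real.enorm_of_nonneg (by positivity),
          mul_assoc B, mul_left_comm, ← ENNReal.ofReal_mul (by positivity),
          ← ENNReal.ofReal_mul (by positivity), Nat.cast_succ]
        congr 2
        field_simp

end Remainder

section VanishingMoments

theorem taylorPoly_neg_smul (n : ℕ) (F : E → ℝ) (x y : E) (c : G) :
    taylorPoly n F x (-y) • c = ∑ m ∈ Finset.range (n + 1),
      ((m.factorial : ℝ)⁻¹ * (-1) ^ m) • iteratedFDeriv ℝ m F x (fun _ => y) • c := by
  rw [taylorPoly, Finset.sum_smul]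
  refine Finset.sum_congr rfl fun m _ => ?_
  have hneg := (iteratedFDeriv ℝ m F x).map_smul_univ (fun _ => (-1 : ℝ)) fun _ => y
  simp only [neg_smul, one_smul, Finset.prod_const, Finset.card_univ, Fintype.card_fin] at hneg
  rw [hneg, smul_smul, smul_assoc]

variable [MeasurableSpace E] [BorelSpace E] {μ : Measure E} {k : E → G} {θ : ℝ} {F : E → ℝ}

theorem integrable_multilinear_diag_smul {m : ℕ} (hmn : m ≤ n) (hθ : 0 ≤ θ)
    (hk : Integrable k μ) (hkα : Integrable (fun y => ‖y‖ ^ (n + θ) * ‖k y‖) μ)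
    (T : E [×m]→L[ℝ] ℝ) : Integrable (fun y => T (fun _ => y) • k y) μ :=
  integrable_smul_of_norm_le_mul_pow hmn hθ hk hkα (by fun_prop) (norm_nonneg T) fun y => by
    simpa using T.le_opNorm fun _ => y

theorem integrable_taylorPoly_neg_smul (hθ : 0 ≤ θ) (hk : Integrable k μ)
    (hkα : Integrable (fun y => ‖y‖ ^ (n + θ) * ‖k y‖) μ) (F : E → ℝ) (x : E) :
    Integrable (fun y => taylorPoly n F x (-y) • k y) μ := by
  simp only [taylorPoly_neg_smul]
  exact integrable_finsetSum _ fun m hm => (integrable_multilinear_diag_smul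
    (Finset.mem_range_succ_iff.1 hm) hθ hk hkα _).smul _

theorem integral_taylorPoly_neg_smul (hθ : 0 ≤ θ) (hk : Integrable k μ)
    (hkα : Integrable (fun y => ‖y‖ ^ (n + θ) * ‖k y‖) μ) {x : E}
    (hmom : ∀ m, 1 ≤ m → m ≤ n → ∫ y, iteratedFDeriv ℝ m F x (fun _ => y) • k y ∂μ = 0) :
    ∫ y, taylorPoly n F x (-y) • k y ∂μ = F x • ∫ y, k y ∂μ := by
  have hterm : ∀ m ∈ Finset.range (n + 1), Integrable (fun y =>
      ((m.factorial : ℝ)⁻¹ * (-1) ^ m) • iteratedFDeriv ℝ m F x (fun _ => y) • k y) μ :=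
    fun m hm => (integrable_multilinear_diag_smul
      (Finset.mem_range_succ_iff.1 hm) hθ hk hkα _).smul _
  simp only [taylorPoly_neg_smul]
  rw [integral_finsetSum _ hterm, Finset.sum_eq_single_of_mem 0 (by simp) fun m hm hm0 => by
    rw [integral_smul, hmom m (Nat.one_le_iff_ne_zero.2 hm0) (Finset.mem_range_succ_iff.1 hm),
      smul_zero]]
  simp [integral_smul]

theorem eLpNorm_taylorPoly_neg_sub_smul_le [SecondCountableTopology E] [SFinite μ]
    {p B : ℝ≥0∞} (hp : 1 ≤ p) (hθ : 0 ≤ θ) (hF : ContDiff ℝ n F)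
    (hB : ∀ h v, eLpNorm (fun x => iteratedFDeriv ℝ n F (x + h) (fun _ => v) -
      iteratedFDeriv ℝ n F x fun _ => v) p μ ≤ B * ENNReal.ofReal (‖h‖ ^ θ * ‖v‖ ^ n))
    (y : E) (c : G) :
    eLpNorm (fun x => (taylorPoly n F x (-y) - F (x - y)) • c) p μ ≤
      B * ENNReal.ofReal (Real.Gamma (θ + 1) / Real.Gamma (n + θ + 1)) *
        ENNReal.ofReal (‖y‖ ^ (n + θ) * ‖c‖) := by
  have hcongr : eLpNorm (fun x => (taylorPoly n F x (-y) - F (x - y)) • c) p μ =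
      eLpNorm (‖c‖ • fun x => F (x + -y) - taylorPoly n F x (-y)) p μ :=
    eLpNorm_congr_norm_ae (.of_forall fun x => by
      rw [Pi.smul_apply, norm_smul, norm_smul, norm_norm, norm_sub_rev, ← sub_eq_add_neg, mul_comm])
  calc eLpNorm (fun x => (taylorPoly n F x (-y) - F (x - y)) • c) p μ
    _ ≤ ‖c‖ₑ * (B * ENNReal.ofReal
          (Real.Gamma (θ + 1) / Real.Gamma (n + θ + 1) * ‖-y‖ ^ (n + θ))) := by
      rw [hcongr, ← enorm_norm c]
      refine eLpNorm_const_smul_le.trans ?_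
      gcongr
      exact eLpNorm_map_add_sub_taylorPoly_le hp hθ hF hB (-y)
    _ = _ := by
      rw [norm_neg, ← ofReal_norm, mul_left_comm, mul_assoc,
        ← ENNReal.ofReal_mul (Gamma_div_Gamma_nonneg n hθ), ← ENNReal.ofReal_mul (norm_nonneg _)]
      congr 2
      ring

theorem eLpNorm_smul_integral_sub_integral_comp_sub_smul_le [SecondCountableTopology E] [SFinite μ]
    {p B : ℝ≥0∞} (hp : 1 ≤ p) (hθ : 0 ≤ θ) (hF : ContDiff ℝ n F) (hk : Integrable k μ)
    (hkα : Integrable (fun y => ‖y‖ ^ (n + θ) * ‖k y‖) μ)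
    (hmom : ∀ m, 1 ≤ m → m ≤ n → ∀ x, ∫ y, iteratedFDeriv ℝ m F x (fun _ => y) • k y ∂μ = 0)
    (hconv : ∀ᵐ x ∂μ, Integrable (fun y => F (x - y) • k y) μ)
    (hB : ∀ h v, eLpNorm (fun x => iteratedFDeriv ℝ n F (x + h) (fun _ => v) -
      iteratedFDeriv ℝ n F x fun _ => v) p μ ≤ B * ENNReal.ofReal (‖h‖ ^ θ * ‖v‖ ^ n)) :
    eLpNorm (fun x => F x • ∫ y, k y ∂μ - ∫ y, F (x - y) • k y ∂μ) p μ ≤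
      B * ENNReal.ofReal (Real.Gamma (θ + 1) / Real.Gamma (n + θ + 1) *
        ∫ y, ‖y‖ ^ (n + θ) * ‖k y‖ ∂μ) := by
  have hremainder : (fun x => F x • ∫ y, k y ∂μ - ∫ y, F (x - y) • k y ∂μ) =ᵐ[μ]
      fun x => ∫ y, (taylorPoly n F x (-y) - F (x - y)) • k y ∂μ := by
    filter_upwards [hconv] with x hx
    simp only [sub_smul]
    rw [integral_sub (integrable_taylorPoly_neg_smul hθ hk hkα F x) hx,
      integral_taylorPoly_neg_smul hθ hk hkα fun m h₁ h₂ => hmom m h₁ h₂ x]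
  have hmeas : AEStronglyMeasurable
      (fun z : E × E => (taylorPoly n F z.1 (-z.2) - F (z.1 - z.2)) • k z.2) (μ.prod μ) := by
    have hT := continuous_taylorPoly hF
    have hTneg : Continuous fun z : E × E => taylorPoly n F z.1 (-z.2) :=
      hT.comp (continuous_fst.prodMk continuous_snd.neg)
    have hF' := hF.continuous
    exact (Continuous.aestronglyMeasurable (by fun_prop)).smul hk.1.comp_snd
  rw [eLpNorm_congr_ae hremainder]
  refine (eLpNorm_integral_le hp hmeas (hkα.1.aemeasurable.ennreal_ofReal.const_mul _)
    (.of_forall fun y => eLpNorm_taylorPoly_neg_sub_smul_le hp hθ hF hB y (k y))).trans_eq ?_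
  rw [lintegral_const_mul'' _ hkα.1.aemeasurable.ennreal_ofReal,
    ← ofReal_integral_eq_lintegral_ofReal hkα (.of_forall fun y => by positivity), mul_assoc,
    ← ENNReal.ofReal_mul (Gamma_div_Gamma_nonneg n hθ)]

end VanishingMoments

end Taylor

section MollifiedError

variable {φ f : Plane → ℝ} {n : ℕ} {θ : ℝ} {p q : ℝ≥0∞}

theorem eLpNorm_mixedDeriv_convolution_translate_sub_le (hθ : 0 < θ) (hp : 1 ≤ p) (hq : q ≠ 0)
    (hφ : ContDiff ℝ (⊤ : ℕ∞) φ) (hc : HasCompactSupport φ) (hφ₁ : eLpNorm φ 1 volume ≤ 1)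
    (hf : LocallyIntegrable f volume) (j : ℕ × ℕ) (h : Plane) :
    eLpNorm (fun x => mixedDeriv j (φ ⋆ f) (x + h) - mixedDeriv j (φ ⋆ f) x) p volume ≤
      ENNReal.ofReal (besovConst θ q * ‖h‖ ^ θ) *
        ⨅ (g : Plane → ℝ) (_ : IsWeakDeriv j f g), besovSeminormFrac θ p q g := by
  rcases eq_or_ne h 0 with rfl | hh
  · simp
  have hpos : ENNReal.ofReal (besovConst θ q * ‖h‖ ^ θ) ≠ 0 := by
    have := besovConst_pos hθ hq
    have := norm_pos_iff.2 hh
    exact (ENNReal.ofReal_pos.2 (by positivity)).ne'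
  simp only [ENNReal.mul_iInf_of_ne hpos ENNReal.ofReal_ne_top]
  refine le_iInf₂ fun g hg => ?_
  have htranslate := eLpNorm_translate_sub_convolution_le hθ hp hq hφ.continuous hc hg.1 (-h)
  rw [norm_neg] at htranslate
  simp only [sub_neg_eq_add] at htranslate
  rw [hg.mixedDeriv_convolution hφ hc hf]
  exact htranslate.trans (mul_le_of_le_one_left' hφ₁)

theorem norm_monomial_le (v : Plane) (a b : ℕ) : ‖v 0 ^ a * v 1 ^ b‖ ≤ ‖v‖ ^ (a + b) := by
  rw [norm_mul, norm_pow, norm_pow, pow_add]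
  gcongr <;> exact PiLp.norm_apply_le v _

theorem contDiff_convolution (hφ : ContDiff ℝ (⊤ : ℕ∞) φ) (hc : HasCompactSupport φ)
    (hf : LocallyIntegrable f volume) : ContDiff ℝ (⊤ : ℕ∞) (φ ⋆ f) :=
  hc.contDiff_convolution_left _ hφ hf

theorem eLpNorm_iteratedFDeriv_convolution_translate_sub_le (hθ : 0 < θ) (hp : 1 ≤ p)
    (hq : q ≠ 0) (hφ : ContDiff ℝ (⊤ : ℕ∞) φ) (hc : HasCompactSupport φ)
    (hφ₁ : eLpNorm φ 1 volume ≤ 1) (hf : LocallyIntegrable f volume) (h v : Plane) :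
    eLpNorm (fun x => iteratedFDeriv ℝ n (φ ⋆ f) (x + h) (fun _ => v) -
      iteratedFDeriv ℝ n (φ ⋆ f) x fun _ => v) p volume ≤
      ENNReal.ofReal (besovConst θ q) * besovSeminorm n θ p q f *
        ENNReal.ofReal (‖h‖ ^ θ * ‖v‖ ^ n) := by
  have hF := contDiff_convolution hφ hc hf
  set D : ℕ × ℕ → Plane → ℝ := fun j x =>
    mixedDeriv j (φ ⋆ f) (x + h) - mixedDeriv j (φ ⋆ f) x with hD
  have hexpand : (fun x => iteratedFDeriv ℝ n (φ ⋆ f) (x + h) (fun _ => v) -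
      iteratedFDeriv ℝ n (φ ⋆ f) x fun _ => v) = ∑ j ∈ Finset.HasAntidiagonal.antidiagonal n,
        ((n.choose j.1 : ℝ) * (v 0 ^ j.1 * v 1 ^ j.2)) • D j := by
    ext x
    simp only [iteratedFDeriv_apply_eq_sum_mixedDeriv hF, ← Finset.sum_sub_distrib,
      Finset.sum_apply, Pi.smul_apply, smul_eq_mul, hD]
    exact Finset.sum_congr rfl fun j _ => by ring
  have hmeas : ∀ j, AEStronglyMeasurable (D j) volume := fun j => by
    have := (contDiff_mixedDeriv hF j).continuous
    exact Continuous.aestronglyMeasurable (by fun_prop)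
  rw [hexpand, besovSeminorm, Finset.mul_sum, Finset.sum_mul]
  refine (eLpNorm_sum_le (fun j _ => (hmeas j).const_smul _) hp).trans
    (Finset.sum_le_sum fun j hj => ?_)
  have hmonomial : ‖(n.choose j.1 : ℝ) * (v 0 ^ j.1 * v 1 ^ j.2)‖ₑ ≤
      (n.choose j.1 : ℝ≥0∞) * ENNReal.ofReal (‖v‖ ^ n) := by
    rw [enorm_mul, Real.enorm_natCast, ← ofReal_norm]
    gcongr
    rw [← Finset.HasAntidiagonal.mem_antidiagonal.1 hj]
    exact norm_monomial_le v j.1 j.2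
  calc eLpNorm (((n.choose j.1 : ℝ) * (v 0 ^ j.1 * v 1 ^ j.2)) • D j) p volume
    _ ≤ (n.choose j.1 : ℝ≥0∞) * ENNReal.ofReal (‖v‖ ^ n) *
        (ENNReal.ofReal (besovConst θ q * ‖h‖ ^ θ) *
          ⨅ (g : Plane → ℝ) (_ : IsWeakDeriv j f g), besovSeminormFrac θ p q g) := by
      refine eLpNorm_const_smul_le.trans ?_
      gcongr
      exact eLpNorm_mixedDeriv_convolution_translate_sub_le hθ hp hq hφ hc hφ₁ hf j h
    _ = _ := by
      rw [ENNReal.ofReal_mul (besovConst_pos hθ hq).le, ENNReal.ofReal_mul (by positivity)]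
      ring

variable {G : Type*} [NormedAddCommGroup G] [NormedSpace ℝ G] {k : Plane → G}

theorem integral_iteratedFDeriv_apply_smul_eq_zero {F : Plane → ℝ}
    (hF : ContDiff ℝ (⊤ : ℕ∞) F) (hθ : 0 ≤ θ) (hk : Integrable k)
    (hkα : Integrable fun y => ‖y‖ ^ (n + θ) * ‖k y‖) {m : ℕ} (hmn : m ≤ n)
    (hmom : ∀ a b : ℕ, a + b = m → ∫ y : Plane, (y 0 ^ a * y 1 ^ b) • k y = 0) (x : Plane) :
    ∫ y, iteratedFDeriv ℝ m F x (fun _ => y) • k y = 0 := by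
  have hexpand : ∀ y, iteratedFDeriv ℝ m F x (fun _ => y) • k y =
      ∑ j ∈ Finset.HasAntidiagonal.antidiagonal m,
        ((m.choose j.1 : ℝ) * mixedDeriv j F x) • (y 0 ^ j.1 * y 1 ^ j.2) • k y := fun y => by
    simp only [iteratedFDeriv_apply_eq_sum_mixedDeriv hF, Finset.sum_smul, smul_smul]
    exact Finset.sum_congr rfl fun j _ => by ring_nf
  have hmonomial : ∀ j ∈ Finset.HasAntidiagonal.antidiagonal m, Integrable fun y : Plane =>
      ((m.choose j.1 : ℝ) * mixedDeriv j F x) • (y 0 ^ j.1 * y 1 ^ j.2) • k y := fun j hj =>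
    (integrable_smul_of_norm_le_mul_pow hmn hθ hk hkα (by fun_prop) zero_le_one fun y => by
      rw [one_mul, ← Finset.HasAntidiagonal.mem_antidiagonal.1 hj]
      exact norm_monomial_le y j.1 j.2).smul _
  simp only [hexpand]
  rw [integral_finsetSum _ hmonomial]
  exact Finset.sum_eq_zero fun j hj => by
    rw [integral_smul, hmom _ _ (Finset.HasAntidiagonal.mem_antidiagonal.1 hj), smul_zero]

theorem convolution_convolution_assoc [CompleteSpace G] (hφ : Continuous φ)
    (hc : HasCompactSupport φ) (hf : Integrable f) (hk : Integrable k) :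
    (φ ⋆ f) ⋆ k = φ ⋆ (f ⋆ k) := by
  ext x
  refine convolution_assoc _ _ _ _ (fun a b z => ?_) hφ.aestronglyMeasurable
    hf.aestronglyMeasurable hk.aestronglyMeasurable ?_ ?_ ?_
  · exact smul_assoc a b z
  · exact .of_forall (hc.convolutionExists_left _ hφ hf.locallyIntegrable)
  · exact hf.norm.ae_convolution_exists _ hk.norm
  · exact hc.norm.convolutionExists_left _ hφ.norm
      (hf.norm.integrable_convolution _ hk.norm).locallyIntegrable x

theorem convolution_smul_const_sub_convolution [CompleteSpace G] (hφ : Continuous φ)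
    (hc : HasCompactSupport φ) (hf : Integrable f) (hk : Integrable k) (c : G) (x : Plane) :
    (φ ⋆ fun y => f y • c - (f ⋆ k) y) x = (φ ⋆ f) x • c - ((φ ⋆ f) ⋆ k) x := by
  have hexists : ∀ {g : Plane → G}, Integrable g →
      ConvolutionExists φ g (ContinuousLinearMap.lsmul ℝ ℝ) volume := fun hg =>
    hc.convolutionExists_left _ hφ hg.locallyIntegrable
  rw [convolution_convolution_assoc hφ hc hf hk, convolution, convolution, convolution,
    ← integral_smul_const, ← integral_sub]
  · simp only [map_sub, ContinuousLinearMap.lsmul_apply, smul_assoc]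
  · exact (hexists (hf.smul_const c) x).congr (.of_forall fun y => (smul_assoc _ _ _).symm)
  · exact hexists (hf.integrable_convolution _ hk) x

theorem eLpNorm_convolution_smul_integral_sub_le (hθ : 0 < θ) (hp : 1 ≤ p)
    (hq : q ≠ 0) (hφ : ContDiff ℝ (⊤ : ℕ∞) φ) (hc : HasCompactSupport φ)
    (hφ₁ : eLpNorm φ 1 volume ≤ 1) (hf : Integrable f) (hk : Integrable k)
    (hkα : Integrable fun y => ‖y‖ ^ (n + θ) * ‖k y‖)
    (hmom : ∀ a b : ℕ, 1 ≤ a + b → a + b ≤ n → ∫ y : Plane, (y 0 ^ a * y 1 ^ b) • k y = 0) :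
    eLpNorm (fun x => (φ ⋆ f) x • (∫ y, k y) - ((φ ⋆ f) ⋆ k) x) p volume ≤
      ENNReal.ofReal (besovConst θ q) * besovSeminorm n θ p q f *
        ENNReal.ofReal (Real.Gamma (θ + 1) / Real.Gamma (n + θ + 1) *
          ∫ y, ‖y‖ ^ (n + θ) * ‖k y‖) := by
  have hF := contDiff_convolution hφ hc hf.locallyIntegrable
  have hFint : Integrable (φ ⋆ f) :=
    (hφ.continuous.integrable_of_hasCompactSupport hc).integrable_convolution _ hf
  simp only [convolution_lsmul_swap (f := φ ⋆ f)]
  refine eLpNorm_smul_integral_sub_integral_comp_sub_smul_le hp hθ.le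
    (hF.of_le (by exact_mod_cast le_top)) hk hkα (fun m hm hmn x => ?_) ?_
    (eLpNorm_iteratedFDeriv_convolution_translate_sub_le hθ hp hq hφ hc hφ₁ hf.locallyIntegrable)
  · exact integral_iteratedFDeriv_apply_smul_eq_zero hF hθ.le hk hkα hmn
      (fun a b hab => hmom a b (hab ▸ hm) (hab ▸ hmn)) x
  · filter_upwards [hFint.ae_convolution_exists (ContinuousLinearMap.lsmul ℝ ℝ) hk] with x hx
    exact convolutionExistsAt_iff_integrable_swap.1 hx

theorem eLpNorm_contDiffBump_normed (ψ : ContDiffBump (0 : Plane)) :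
    eLpNorm (ψ.normed volume) 1 volume = 1 := by
  rw [eLpNorm_one_eq_lintegral_enorm]
  simp only [Real.enorm_of_nonneg (ψ.nonneg_normed _)]
  rw [← ofReal_integral_eq_lintegral_ofReal ψ.integrable_normed (.of_forall ψ.nonneg_normed),
    ψ.integral_normed, ENNReal.ofReal_one]

theorem eLpNorm_le_of_forall_contDiffBump_convolution_le [CompleteSpace G] {g : Plane → G}
    (hg : LocallyIntegrable g volume) {C : ℝ≥0∞}
    (hC : ∀ ψ : ContDiffBump (0 : Plane), eLpNorm (ψ.normed volume ⋆ g) p volume ≤ C) :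
    eLpNorm g p volume ≤ C := by
  let ψ : ℕ → ContDiffBump (0 : Plane) := fun i =>
    { rIn := 1 / ((i : ℝ) + 1)
      rOut := 2 * (1 / ((i : ℝ) + 1))
      rIn_pos := Nat.one_div_pos_of_nat
      rIn_lt_rOut := lt_two_mul_self Nat.one_div_pos_of_nat }
  have hradius : Tendsto (fun i => (ψ i).rOut) atTop (𝓝 0) := by
    simpa only [mul_zero] using tendsto_one_div_add_atTop_nhds_zero_nat.const_mul (2 : ℝ)
  have hlim := ContDiffBump.ae_convolution_tendsto_right_of_locallyIntegrable (K := 2) hradius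
    (.of_forall fun i => le_rfl) hg
  refine Lp.eLpNorm_le_of_ae_tendsto (.of_forall fun i => hC (ψ i)) (fun i => ?_) hlim
  exact ((ψ i).hasCompactSupport_normed.continuous_convolution_left _
    (ψ i).continuous_normed hg).aestronglyMeasurable

theorem eLpNorm_smul_integral_sub_convolution_le [CompleteSpace G] (hθ : 0 < θ) (hp : 1 ≤ p)
    (hq : q ≠ 0) (hf : Integrable f) (hk : Integrable k)
    (hkα : Integrable fun y => ‖y‖ ^ (n + θ) * ‖k y‖)
    (hmom : ∀ a b : ℕ, 1 ≤ a + b → a + b ≤ n → ∫ y : Plane, (y 0 ^ a * y 1 ^ b) • k y = 0) :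
    eLpNorm (fun x => f x • (∫ y, k y) - (f ⋆ k) x) p volume ≤
      ENNReal.ofReal (besovConst θ q * (Real.Gamma (θ + 1) / Real.Gamma (n + θ + 1)) *
        ∫ y, ‖y‖ ^ (n + θ) * ‖k y‖) * besovSeminorm n θ p q f := by
  have herror : Integrable fun x => f x • (∫ y, k y) - (f ⋆ k) x :=
    (hf.smul_const _).sub (hf.integrable_convolution (ContinuousLinearMap.lsmul ℝ ℝ) hk)
  refine eLpNorm_le_of_forall_contDiffBump_convolution_le herror.locallyIntegrable fun ψ => ?_
  have hψ := ψ.continuous_normed (μ := volume)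
  have hψc := ψ.hasCompactSupport_normed (μ := volume)
  rw [funext (convolution_smul_const_sub_convolution hψ hψc hf hk _)]
  refine (eLpNorm_convolution_smul_integral_sub_le hθ hp hq ψ.contDiff_normed hψc
    (eLpNorm_contDiffBump_normed ψ).le hf hk hkα hmom).trans_eq ?_
  rw [mul_right_comm, ← ENNReal.ofReal_mul (besovConst_pos hθ hq).le, mul_assoc (besovConst θ q)]

end MollifiedError

section FilteredBackProjection

/-- The unit vector with angle `ϑ`. -/
def direction (ϑ : ℝ) : Plane :=
  !₂[Real.cos ϑ, Real.sin ϑ]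

theorem continuous_direction : Continuous direction := by
  unfold direction
  fun_prop

@[simp]
theorem norm_direction (ϑ : ℝ) : ‖direction ϑ‖ = 1 := by
  simp [direction, EuclideanSpace.norm_eq]

theorem inner_direction (x : Plane) (ϑ : ℝ) :
    ⟪x, direction ϑ⟫ = x 0 * Real.cos ϑ + x 1 * Real.sin ϑ := by
  simp [direction, PiLp.inner_apply, mul_comm]

theorem direction_sub_pi (ϑ : ℝ) : direction (ϑ - π) = -direction ϑ := by
  ext i
  fin_cases i <;> simp [direction]

theorem lintegral_eq_lintegral_polar {g : Plane → ℝ≥0∞} (hg : Measurable g) :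
    ∫⁻ ξ, g ξ = ∫⁻ ϑ in Ioo (-π) π, ∫⁻ S in Ioi 0, ENNReal.ofReal S * g (S • direction ϑ) := by
  have hcoord : MeasurePreserving
      (MeasurableEquiv.finTwoArrow.symm.trans (MeasurableEquiv.toLp 2 (Fin 2 → ℝ))) :=
    (EuclideanSpace.volume_preserving_symm_measurableEquiv_toLp (Fin 2)).symm.comp
      (volume_preserving_finTwoArrow ℝ).symm
  have hpolar : ∀ z : ℝ × ℝ, (MeasurableEquiv.finTwoArrow.symm.trans
      (MeasurableEquiv.toLp 2 (Fin 2 → ℝ))) (polarCoord.symm z) = z.1 • direction z.2 := by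
    intro z
    ext i
    fin_cases i <;> rfl
  have hmeas : Measurable fun z : ℝ × ℝ => ENNReal.ofReal z.1 * g (z.1 • direction z.2) :=
    (measurable_fst.ennreal_ofReal).mul (hg.comp
      (continuous_fst.smul (continuous_direction.comp continuous_snd)).measurable)
  rw [← hcoord.lintegral_comp hg, ← lintegral_comp_polarCoord_symm]
  simp only [hpolar, smul_eq_mul, polarCoord_target]
  rw [Measure.volume_eq_prod, ← Measure.prod_restrict, lintegral_prod_symm' _ hmeas]

/-- The measure `|S| dS`, the radial part of the Lebesgue measure of the plane. -/
def radialMeasure : Measure ℝ :=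
  volume.withDensity fun S => ENNReal.ofReal |S|

theorem lintegral_radialMeasure {g : ℝ → ℝ≥0∞} (hg : Measurable g) :
    ∫⁻ S, g S ∂radialMeasure =
      (∫⁻ S in Ioi 0, ENNReal.ofReal S * g S) + ∫⁻ S in Ioi 0, ENNReal.ofReal S * g (-S) := by
  rw [radialMeasure, lintegral_withDensity_eq_lintegral_mul _ (by fun_prop) hg,
    ← lintegral_add_compl _ (measurableSet_Ioi (a := (0 : ℝ))), compl_Ioi]
  congr 1
  · exact setLIntegral_congr_fun measurableSet_Ioi fun S hS => by
      simp [abs_of_pos (show 0 < S from hS)]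
  · rw [setLIntegral_congr Iio_ae_eq_Iic.symm,
      ← (Measure.measurePreserving_neg (volume : Measure ℝ)).setLIntegral_comp_preimage_emb
        (MeasurableEquiv.neg ℝ).measurableEmbedding]
    simp only [Set.neg_preimage, Set.neg_Iio, neg_zero]
    exact setLIntegral_congr_fun measurableSet_Ioi fun S hS => by
      simp [abs_of_pos (show 0 < S from hS)]

instance : SFinite radialMeasure := by
  unfold radialMeasure
  infer_instance

theorem measurePreserving_signedPolar :
    MeasurePreserving (fun z : ℝ × ℝ => z.2 • direction z.1)
      ((volume.restrict (Ioo 0 π)).prod radialMeasure) volume := by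
  have hP : Measurable fun z : ℝ × ℝ => z.2 • direction z.1 :=
    (continuous_snd.smul (continuous_direction.comp continuous_fst)).measurable
  refine ⟨hP, Measure.ext_of_lintegral _ fun g hg => ?_⟩
  have hJ : Measurable fun ϑ => ∫⁻ S in Ioi 0, ENNReal.ofReal S * g (S • direction ϑ) :=
    Measurable.lintegral_prod_right' (f := fun z : ℝ × ℝ =>
      ENNReal.ofReal z.2 * g (z.2 • direction z.1)) (by fun_prop)
  have hneg : ∫⁻ ϑ in Ioo (-π) 0, ∫⁻ S in Ioi 0, ENNReal.ofReal S * g (S • direction ϑ) =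
      ∫⁻ ϑ in Ioo 0 π, ∫⁻ S in Ioi 0, ENNReal.ofReal S * g (-S • direction ϑ) := by
    rw [← (measurePreserving_sub_right volume π).setLIntegral_comp_preimage_emb
        (MeasurableEquiv.subRight π).measurableEmbedding]
    simp [direction_sub_pi]
  have hsplit : Ioo (-π) π =ᵐ[volume] (Ioo (-π) 0 ∪ Ioo 0 π : Set ℝ) := by
    rw [← Ioo_union_Ico_eq_Ioo (neg_lt_zero.2 Real.pi_pos) Real.pi_pos.le]
    exact (ae_eq_refl _).union Ioo_ae_eq_Ico.symm
  have hdisj : Disjoint (Ioo (-π) 0) (Ioo 0 π) :=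
    Set.disjoint_left.2 fun _ h h' => h.2.not_gt h'.1
  calc ∫⁻ ξ, g ξ ∂Measure.map _ _
    _ = ∫⁻ ϑ in Ioo 0 π, ∫⁻ S, g (S • direction ϑ) ∂radialMeasure := by
        rw [lintegral_map hg hP]
        exact lintegral_prod _ (hg.comp hP).aemeasurable
    _ = (∫⁻ ϑ in Ioo 0 π, ∫⁻ S in Ioi 0, ENNReal.ofReal S * g (S • direction ϑ)) +
        ∫⁻ ϑ in Ioo (-π) 0, ∫⁻ S in Ioi 0, ENNReal.ofReal S * g (S • direction ϑ) := by
        rw [hneg, ← lintegral_add_left hJ]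
        exact lintegral_congr fun ϑ =>
          lintegral_radialMeasure (hg.comp (hP.comp measurable_prodMk_left))
    _ = ∫⁻ ξ, g ξ := by
        rw [lintegral_eq_lintegral_polar hg, setLIntegral_congr hsplit,
          lintegral_union measurableSet_Ioo hdisj, add_comm]

theorem integral_eq_integral_signedPolar {E : Type*} [NormedAddCommGroup E] [NormedSpace ℝ E]
    {g : Plane → E} (hg : Integrable g) :
    ∫ ξ, g ξ = ∫ ϑ in Ioo 0 π, ∫ S : ℝ, |S| • g (S • direction ϑ) := by
  have hmp := measurePreserving_signedPolar
  have hmap := integral_map hmp.measurable.aemeasurable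
    (hmp.map_eq ▸ hg.aestronglyMeasurable : AEStronglyMeasurable g (Measure.map _ _))
  rw [hmp.map_eq] at hmap
  have hprod := integral_prod _ (hmp.integrable_comp_of_integrable hg)
  simp only [Function.comp_apply] at hprod
  rw [hmap, hprod]
  refine integral_congr_ae (.of_forall fun ϑ => ?_)
  simp only [radialMeasure]
  rw [integral_withDensity_eq_integral_toReal_smul (by fun_prop) (by simp)]
  simp

/-- The signed radial coordinate `S` of the point `S • direction ϑ`, where `0 < ϑ < π`. -/
def signedNorm (ξ : Plane) : ℝ :=
  if 0 < ξ 1 then ‖ξ‖ else -‖ξ‖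

theorem abs_signedNorm (ξ : Plane) : |signedNorm ξ| = ‖ξ‖ := by
  unfold signedNorm
  split_ifs <;> simp

theorem measurable_signedNorm : Measurable signedNorm :=
  Measurable.ite (measurableSet_lt measurable_const (by fun_prop)) measurable_norm
    measurable_norm.neg

theorem signedNorm_smul_direction {ϑ : ℝ} (hϑ : ϑ ∈ Ioo 0 π) (S : ℝ) :
    signedNorm (S • direction ϑ) = S := by
  have hsin : 0 < Real.sin ϑ := Real.sin_pos_of_mem_Ioo hϑ
  have hiff : 0 < (S • direction ϑ) 1 ↔ 0 < S := by simp [direction, hsin]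
  rcases lt_or_ge 0 S with hS | hS
  · rw [signedNorm, if_pos (hiff.2 hS), norm_smul, norm_direction, mul_one,
      Real.norm_of_nonneg hS.le]
  · rw [signedNorm, if_neg (hiff.not.2 hS.not_gt), norm_smul, norm_direction, mul_one,
      Real.norm_of_nonpos hS, neg_neg]

theorem map_signedNorm : (volume : Measure Plane).map signedNorm =
    ENNReal.ofReal π • radialMeasure := by
  have hmp := measurePreserving_signedPolar
  have hsnd : (signedNorm ∘ fun z : ℝ × ℝ => z.2 • direction z.1) =ᵐ[
      (volume.restrict (Ioo 0 π)).prod radialMeasure] Prod.snd := by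
    filter_upwards [Measure.quasiMeasurePreserving_fst.ae (ae_restrict_mem measurableSet_Ioo)]
      with z hz using signedNorm_smul_direction hz z.2
  rw [← hmp.map_eq, Measure.map_map measurable_signedNorm hmp.measurable, Measure.map_congr hsnd,
    Measure.map_snd_prod]
  simp

/-- The Fourier multiplier on the plane associated with the window `W` and the bandwidth `L`: in
signed polar coordinates and for the frequency normalisation `e^{-2πi⟪x, ξ⟫}` it is `W(2πS / L)`. -/
def symbol (W : ℝ → ℝ) (L : ℝ) (ξ : Plane) : ℂ :=
  W (2 * π * signedNorm ξ / L)

variable {W : ℝ → ℝ} {L : ℝ}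

theorem integrable_symbol (hA : Integrable (lowPass W 1)) (hL : 0 < L) :
    Integrable (symbol W L) := by
  have hradial : Integrable (fun S => W (2 * π * S / L)) radialMeasure := by
    rw [radialMeasure, integrable_withDensity_iff_integrable_smul' (by fun_prop) (by simp)]
    refine ((hA.comp_div (R := L / (2 * π)) (by positivity)).const_mul (L / (2 * π))).congr
      (.of_forall fun S => ?_)
    simp only [lowPass, abs_div, abs_mul, abs_of_pos hL, abs_of_pos Real.pi_pos, smul_eq_mul,
      Nat.abs_ofNat, div_one, abs_nonneg, ENNReal.toReal_ofReal]
    field_simp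
  refine Integrable.ofReal (𝕜 := ℂ) (Integrable.comp_measurable (f := signedNorm)
    (g := fun S => W (2 * π * S / L)) ?_ measurable_signedNorm)
  rw [map_signedNorm]
  exact hradial.smul_measure ENNReal.ofReal_ne_top

theorem symbol_zero : symbol W L 0 = W 0 := by
  simp [symbol, signedNorm]

theorem continuousAt_symbol (hW : ContinuousAt W 0) : ContinuousAt (symbol W L) 0 := by
  have hnorm : Tendsto signedNorm (𝓝 0) (𝓝 0) := by
    rw [tendsto_zero_iff_abs_tendsto_zero]
    simpa only [Function.comp_def, abs_signedNorm] using tendsto_norm_zero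
  have hlim : Tendsto (fun ξ => 2 * π * signedNorm ξ / L) (𝓝 0) (𝓝 0) := by
    simpa using (hnorm.const_mul (2 * π)).div_const L
  rw [ContinuousAt, symbol_zero]
  exact (Complex.continuous_ofReal.tendsto _).comp (hW.tendsto.comp hlim)

theorem integral_abs_smul_comp_div {E : Type*} [NormedAddCommGroup E] [NormedSpace ℝ E]
    (g : ℝ → E) {c : ℝ} (hc : 0 < c) :
    ∫ S : ℝ, |S| • g (S / c) = c ^ 2 • ∫ S : ℝ, |S| • g S := by
  have hcomp := Measure.integral_comp_div (fun S : ℝ => c • |S| • g S) c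
  simp only [abs_div, abs_of_pos hc, ← mul_smul, mul_div_cancel₀ _ hc.ne'] at hcomp
  simp only [mul_smul, integral_smul] at hcomp
  rw [hcomp, sq, mul_smul]

/-- In signed polar coordinates `ξ = (S / 2π) • direction ϑ`, the Jacobian `|S| / 4π²` is the ramp
filter of filtered back projection. -/
theorem half_mul_backProj_fourierInv {g : Plane → ℂ} (hg : Integrable g) {a : ℝ → ℝ → ℂ}
    (ha : ∀ ϑ ∈ Ioo 0 π, ∀ S, a S ϑ = |S| * g ((S / (2 * π)) • direction ϑ)) (x : Plane) :
    1 / 2 * backProj (fun t ϑ => fourierInv (a · ϑ) t) x = 𝓕⁻ g x := by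
  set G : Plane → ℂ := fun ξ => Complex.exp (↑(2 * π * ⟪ξ, x⟫) * Complex.I) • g ξ with hG
  have hGint : Integrable G := hg.bdd_smul 1 (Continuous.aestronglyMeasurable (by fun_prop))
    (.of_forall fun ξ => (Complex.norm_exp_ofReal_mul_I _).le)
  have hray : ∀ ϑ ∈ Ioo 0 π, ∫ S : ℝ, a S ϑ * Complex.exp
        (Complex.I * ↑(x 0 * Real.cos ϑ + x 1 * Real.sin ϑ) * S) =
      (2 * π) ^ 2 * ∫ S : ℝ, |S| • G (S • direction ϑ) := by
    intro ϑ hϑ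
    have hphase : ∀ S : ℝ, Complex.I * ↑(x 0 * Real.cos ϑ + x 1 * Real.sin ϑ) * S =
        ↑(2 * π * ⟪(S / (2 * π)) • direction ϑ, x⟫) * Complex.I := by
      intro S
      rw [real_inner_smul_left, real_inner_comm, inner_direction, ← mul_assoc,
        mul_div_cancel₀ _ Real.two_pi_pos.ne']
      push_cast
      ring
    have hsubst := integral_abs_smul_comp_div (fun S => G (S • direction ϑ)) Real.two_pi_pos
    rw [Complex.real_smul] at hsubst
    push_cast at hsubst
    rw [← hsubst]
    refine integral_congr_ae (.of_forall fun S => ?_)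
    simp only [hG, ha ϑ hϑ, hphase, Complex.real_smul, smul_eq_mul]
    ring
  rw [Real.fourierInv_eq', integral_eq_integral_signedPolar hGint, backProj,
    intervalIntegral.integral_of_le Real.pi_pos.le, integral_Ioc_eq_integral_Ioo]
  simp only [fourierInv]
  rw [setIntegral_congr_fun measurableSet_Ioo fun ϑ hϑ => congrArg _ (hray ϑ hϑ)]
  simp only [integral_const_mul]
  field_simp

theorem kernel_eq_fourierInv_symbol (hA : Integrable (lowPass W 1)) (hL : 0 < L) :
    kernel W L = 𝓕⁻ (symbol W L) := by
  ext x
  refine half_mul_backProj_fourierInv (integrable_symbol hA hL) (fun ϑ hϑ S => ?_) x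
  rw [symbol, signedNorm_smul_direction hϑ, mul_div_cancel₀ _ Real.two_pi_pos.ne', lowPass]
  push_cast
  rfl

theorem integral_kernel (hA : Integrable (lowPass W 1)) (hL : 0 < L)
    (hK : Integrable (kernel W L)) (hW : ContinuousAt W 0) : ∫ x, kernel W L x = W 0 := by
  have hm := integrable_symbol hA hL
  have hinv : 𝓕 (𝓕⁻ (symbol W L)) 0 = symbol W L 0 := by
    refine hm.fourier_fourierInv_eq ?_ (continuousAt_symbol hW)
    rw [kernel_eq_fourierInv_symbol hA hL] at hK
    simpa only [Real.fourierInv_eq_fourier_neg, neg_neg] using hK.comp_neg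
  rw [← symbol_zero, ← hinv, kernel_eq_fourierInv_symbol hA hL, Real.fourier_eq]
  simp

theorem fourierInv_mul_fourier {V : Type*} [NormedAddCommGroup V] [InnerProductSpace ℝ V]
    [FiniteDimensional ℝ V] [MeasurableSpace V] [BorelSpace V] {m : V → ℂ} {f : V → ℝ}
    (hm : Integrable m) (hf : Integrable f) :
    𝓕⁻ (fun ξ => m ξ * 𝓕 (fun y => (f y : ℂ)) ξ) = f ⋆ 𝓕⁻ m := by
  ext x
  have hshift : Integrable fun ξ => 𝐞 ⟪ξ, x⟫ • m ξ := by
    have h := (Real.fourierIntegral_convergent_iff (-x)).2 hm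
    simpa using h
  have hflip := VectorFourier.integral_fourierIntegral_smul_eq_flip (L := innerₗ V)
    (f := fun y => (f y : ℂ)) (μ := volume) (ν := volume) Real.continuous_fourierChar
    continuous_inner hf.ofReal hshift
  calc 𝓕⁻ (fun ξ => m ξ * 𝓕 (fun y => (f y : ℂ)) ξ) x
    _ = ∫ ξ, 𝓕 (fun y => (f y : ℂ)) ξ • 𝐞 ⟪ξ, x⟫ • m ξ := by
        simp only [Real.fourierInv_eq, Circle.smul_def, smul_eq_mul]
        exact integral_congr_ae (.of_forall fun ξ => by ring)
    _ = ∫ t, (f t : ℂ) • ∫ ξ, 𝐞 (-⟪ξ, t⟫) • 𝐞 ⟪ξ, x⟫ • m ξ :=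
        hflip.trans (by simp [VectorFourier.fourierIntegral])
    _ = (f ⋆ 𝓕⁻ m) x := by
        simp only [convolution, Real.fourierInv_eq, smul_smul, ← AddChar.map_add_eq_mul,
          inner_sub_right, neg_add_eq_sub]
        rfl

theorem signedNorm_smul {r : ℝ} (hr : 0 < r) (ξ : Plane) :
    signedNorm (r • ξ) = r * signedNorm ξ := by
  simp only [signedNorm, PiLp.smul_apply, smul_eq_mul, mul_pos_iff_of_pos_left hr, norm_smul,
    Real.norm_of_nonneg hr.le]
  split_ifs <;> ring

theorem kernel_eq_smul_comp_smul (hA : Integrable (lowPass W 1)) (hL : 0 < L) (x : Plane) :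
    kernel W L x = L ^ 2 • kernel W 1 (L • x) := by
  have hsymbol : ∀ ξ, symbol W L ξ = symbol W 1 (L⁻¹ • ξ) := by
    intro ξ
    simp only [symbol, signedNorm_smul (inv_pos.2 hL), div_one]
    congr 2
    ring
  have hsubst := Measure.integral_comp_inv_smul_of_nonneg volume
    (fun ξ : Plane => 𝐞 ⟪ξ, L • x⟫ • symbol W 1 ξ) hL.le
  rw [finrank_euclideanSpace_fin] at hsubst
  rw [kernel_eq_fourierInv_symbol hA hL, kernel_eq_fourierInv_symbol hA one_pos,
    Real.fourierInv_eq, Real.fourierInv_eq, ← hsubst]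
  simp only [hsymbol, real_inner_smul_left, real_inner_smul_right, mul_inv_cancel_left₀ hL.ne']

/-- The rotation of the plane by the angle `ϑ`. -/
def rotation (ϑ : ℝ) : Plane →ₗᵢ[ℝ] Plane where
  toFun x := !₂[x 0 * Real.cos ϑ - x 1 * Real.sin ϑ, x 0 * Real.sin ϑ + x 1 * Real.cos ϑ]
  map_add' x y := by
    ext i
    fin_cases i <;> simp <;> ring
  map_smul' c x := by
    ext i
    fin_cases i <;> simp <;> ring
  norm_map' x := by
    simp only [EuclideanSpace.norm_eq, Fin.sum_univ_two, Real.norm_eq_abs, sq_abs]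
    congr 1
    simp only [LinearMap.coe_mk, AddHom.coe_mk, Matrix.cons_val_zero, Matrix.cons_val_one]
    linear_combination (x 0 ^ 2 + x 1 ^ 2) * Real.sin_sq_add_cos_sq ϑ

/-- The coordinates `(t, s)` in which the lines with normal `direction ϑ` are the sets `t = const`,
parametrised by arc length. -/
def lineCoords (ϑ : ℝ) : ℝ × ℝ ≃ᵐ Plane :=
  (MeasurableEquiv.finTwoArrow.symm.trans (MeasurableEquiv.toLp 2 (Fin 2 → ℝ))).trans
    ((rotation ϑ).toLinearIsometryEquiv rfl).toHomeomorph.toMeasurableEquiv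

theorem lineCoords_apply (ϑ t s : ℝ) : lineCoords ϑ (t, s) =
    !₂[t * Real.cos ϑ - s * Real.sin ϑ, t * Real.sin ϑ + s * Real.cos ϑ] := rfl

theorem inner_lineCoords_direction (ϑ t s : ℝ) : ⟪lineCoords ϑ (t, s), direction ϑ⟫ = t := by
  simp only [inner_direction, lineCoords_apply, Matrix.cons_val_zero, Matrix.cons_val_one]
  linear_combination t * Real.sin_sq_add_cos_sq ϑ

theorem measurePreserving_lineCoords (ϑ : ℝ) :
    MeasurePreserving (lineCoords ϑ) (volume.prod volume) volume :=
  (((rotation ϑ).toLinearIsometryEquiv rfl).measurePreserving.comp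
    (EuclideanSpace.volume_preserving_symm_measurableEquiv_toLp (Fin 2)).symm).comp
      (volume_preserving_finTwoArrow ℝ).symm

/-- The **Fourier slice theorem**. -/
theorem fourier_radon {f : Plane → ℝ} (hf : Integrable f) (ϑ S : ℝ) :
    fourier (fun t => (radon f t ϑ : ℂ)) S =
      𝓕 (fun y => (f y : ℂ)) ((S / (2 * π)) • direction ϑ) := by
  set G : Plane → ℂ := fun y =>
    Complex.exp (↑(-2 * π * ⟪y, (S / (2 * π)) • direction ϑ⟫) * Complex.I) • (f y : ℂ) with hG
  have hGint : Integrable G := hf.ofReal.bdd_smul 1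
    (Continuous.aestronglyMeasurable (by fun_prop))
    (.of_forall fun y => (Complex.norm_exp_ofReal_mul_I _).le)
  have hline : ∀ t s, G (lineCoords ϑ (t, s)) =
      (f (lineCoords ϑ (t, s)) : ℂ) * Complex.exp (-(Complex.I * t * S)) := by
    intro t s
    simp only [hG, real_inner_smul_right, inner_lineCoords_direction, smul_eq_mul]
    rw [mul_comm]
    congr 2
    push_cast
    field_simp
  have hmp := measurePreserving_lineCoords ϑ
  calc fourier (fun t => (radon f t ϑ : ℂ)) S = ∫ t, ∫ s, G (lineCoords ϑ (t, s)) := by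
        simp only [hline, integral_mul_const]
        simp only [fourier, radon, lineCoords_apply, integral_complex_ofReal]
    _ = ∫ z, G (lineCoords ϑ z) ∂volume.prod volume := (integral_prod _
        ((hmp.integrable_comp_emb (lineCoords ϑ).measurableEmbedding).2 hGint)).symm
    _ = 𝓕 (fun y => (f y : ℂ)) ((S / (2 * π)) • direction ϑ) := by
        rw [hmp.integral_comp (lineCoords ϑ).measurableEmbedding, Real.fourier_eq']

theorem fbp_eq_convolution_kernel (hA : Integrable (lowPass W 1)) (hL : 0 < L) {f : Plane → ℝ}
    (hf : Integrable f) : fbp W L f = f ⋆ kernel W L := by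
  have hm := integrable_symbol hA hL
  have hmul : Integrable fun ξ => symbol W L ξ * 𝓕 (fun y => (f y : ℂ)) ξ := by
    refine hm.mul_bdd (c := ∫ y, ‖(f y : ℂ)‖) ?_ (.of_forall fun ξ => ?_)
    · exact (VectorFourier.fourierIntegral_continuous Real.continuous_fourierChar
        continuous_inner hf.ofReal).aestronglyMeasurable
    · exact VectorFourier.norm_fourierIntegral_le_integral_norm _ _ _ _ _
  rw [kernel_eq_fourierInv_symbol hA hL, ← fourierInv_mul_fourier hm hf]
  ext x
  refine half_mul_backProj_fourierInv hmul (fun ϑ hϑ S => ?_) x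
  rw [fourier_radon hf, symbol, signedNorm_smul_direction hϑ,
    mul_div_cancel₀ _ Real.two_pi_pos.ne', lowPass]
  push_cast
  ring

section Scaling

theorem integral_comp_smul_plane {E : Type*} [NormedAddCommGroup E] [NormedSpace ℝ E]
    (hL : 0 < L) (g : Plane → E) : L ^ 2 • ∫ y, g (L • y) = ∫ y, g y := by
  rw [Measure.integral_comp_smul, finrank_euclideanSpace_fin, abs_of_pos (by positivity),
    smul_inv_smul₀ (by positivity)]

theorem integrable_kernel (hA : Integrable (lowPass W 1)) (hL : 0 < L)
    (hK : Integrable (kernel W 1)) : Integrable (kernel W L) := by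
  rw [funext (kernel_eq_smul_comp_smul hA hL)]
  exact (hK.comp_smul hL.ne').smul (L ^ 2)

theorem integral_monomial_smul_kernel (hA : Integrable (lowPass W 1)) (hL : 0 < L) (a b : ℕ) :
    ∫ y : Plane, (y 0 ^ a * y 1 ^ b) • kernel W L y =
      (L ^ (a + b))⁻¹ • ∫ y : Plane, (y 0 ^ a * y 1 ^ b) • kernel W 1 y := by
  rw [← integral_comp_smul_plane hL fun y => (y 0 ^ a * y 1 ^ b) • kernel W 1 y, ← integral_smul,
    ← integral_smul]
  refine integral_congr_ae (.of_forall fun y => ?_)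
  simp only [kernel_eq_smul_comp_smul hA hL, PiLp.smul_apply, smul_eq_mul, smul_smul, mul_pow,
    pow_add]
  congr 1
  field_simp

theorem rpow_norm_mul_norm_kernel (hA : Integrable (lowPass W 1)) (hL : 0 < L) (α : ℝ)
    (y : Plane) : ‖y‖ ^ α * ‖kernel W L y‖ =
      L ^ (-α) * (L ^ 2 * (‖L • y‖ ^ α * ‖kernel W 1 (L • y)‖)) := by
  rw [kernel_eq_smul_comp_smul hA hL, norm_smul, norm_pow, norm_smul, Real.norm_of_nonneg hL.le,
    Real.mul_rpow hL.le (norm_nonneg _), Real.rpow_neg hL.le]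
  field_simp

theorem integrable_rpow_norm_mul_norm_kernel (hA : Integrable (lowPass W 1)) (hL : 0 < L) {α : ℝ}
    (hKα : Integrable fun y : Plane => ‖y‖ ^ α * ‖kernel W 1 y‖) :
    Integrable fun y : Plane => ‖y‖ ^ α * ‖kernel W L y‖ := by
  simp only [rpow_norm_mul_norm_kernel hA hL]
  exact ((hKα.comp_smul hL.ne').const_mul _).const_mul _

theorem integral_rpow_norm_mul_norm_kernel (hA : Integrable (lowPass W 1)) (hL : 0 < L) (α : ℝ) :
    ∫ y : Plane, ‖y‖ ^ α * ‖kernel W L y‖ =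
      (∫ y : Plane, ‖y‖ ^ α * ‖kernel W 1 y‖) * L ^ (-α) := by
  simp only [rpow_norm_mul_norm_kernel hA hL]
  rw [integral_const_mul, integral_const_mul, mul_comm, ← smul_eq_mul (L ^ 2),
    integral_comp_smul_plane hL fun y => ‖y‖ ^ α * ‖kernel W 1 y‖]

end Scaling

end FilteredBackProjection

end FBP

end

theorem mainTheorem2_general
    (n : ℕ) (θ : ℝ) (hθ : 0 < θ) (p q : ℝ≥0∞) (hp : 1 ≤ p) (hq : q ≠ 0)
    (f : FBP.Plane → ℝ) (hf : Integrable f) (hfB : FBP.besovSeminorm n θ p q f < ∞)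
    (W : ℝ → ℝ) (hW0 : W 0 = 1) (hW : ContinuousAt W 0) (hA : Integrable (FBP.lowPass W 1))
    (hK : Integrable (FBP.kernel W 1))
    (hmom : ∀ j₁ j₂ : ℕ, 1 ≤ j₁ + j₂ → j₁ + j₂ ≤ n →
      ∫ x : FBP.Plane, ((x 0 ^ j₁ * x 1 ^ j₂ : ℝ) : ℂ) * FBP.kernel W 1 x = 0)
    (hKα : Integrable fun x : FBP.Plane => ‖x‖ ^ (n + θ) * ‖FBP.kernel W 1 x‖)
    (L : ℝ) (hL : 0 < L) :
    MemLp (fun x => (f x : ℂ) - FBP.fbp W L f x) p volume ∧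
      eLpNorm (fun x => (f x : ℂ) - FBP.fbp W L f x) p volume ≤
        ENNReal.ofReal
          (FBP.besovConst θ q * (Real.Gamma (θ + 1) / Real.Gamma (n + θ + 1)) *
            (∫ x : FBP.Plane, ‖x‖ ^ (n + θ) * ‖FBP.kernel W 1 x‖) * L ^ (-(n + θ))) *
          FBP.besovSeminorm n θ p q f := by
  have hKL := FBP.integrable_kernel hA hL hK
  have hmass : ∫ x, FBP.kernel W L x = 1 := by
    rw [FBP.integral_kernel hA hL hKL hW, hW0, Complex.ofReal_one]
  have herror := FBP.eLpNorm_smul_integral_sub_convolution_le (n := n) hθ hp hq hf hKL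
    (FBP.integrable_rpow_norm_mul_norm_kernel hA hL hKα) fun a b h₁ h₂ => by
      rw [FBP.integral_monomial_smul_kernel hA hL]
      simp only [Complex.real_smul, hmom a b h₁ h₂, mul_zero]
  rw [← FBP.fbp_eq_convolution_kernel hA hL hf, FBP.integral_rpow_norm_mul_norm_kernel hA hL,
    ← mul_assoc] at herror
  simp only [hmass, Complex.real_smul, mul_one] at herror
  refine ⟨⟨?_, herror.trans_lt (ENNReal.mul_lt_top ENNReal.ofReal_lt_top hfB)⟩, herror⟩
  rw [FBP.fbp_eq_convolution_kernel hA hL hf]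
  exact (hf.ofReal.sub
    (hf.integrable_convolution (ContinuousLinearMap.lsmul ℝ ℝ) hKL)).aestronglyMeasurable

theorem mainTheorem2
    (n : ℕ) (hn : 1 ≤ n) (θ : ℝ) (hθ0 : 0 < θ) (hθ1 : θ < 1) (α : ℝ) (hα : α = n + θ)
    (p q : ℝ≥0∞) (hp : 1 ≤ p) (hq : 1 ≤ q)
    (f : FBP.Plane → ℝ) (hf1 : MemLp f 1 volume) (hf : FBP.MemBesov n θ p q f)
    (W : ℝ → ℝ) (hW : MemLp W ∞ volume) (hWeven : Function.Even W)
    (hW0 : W 0 = 1) (hWcont : ContinuousAt W 0)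
    (hA1 : MemLp (FBP.lowPass W 1) 1 volume) (hA2 : MemLp (FBP.lowPass W 1) 2 volume)
    (hK : Integrable (FBP.kernel W 1) volume)
    (hmom : ∀ j₁ j₂ : ℕ, 1 ≤ j₁ + j₂ → j₁ + j₂ ≤ n →
      ∫ x : FBP.Plane, ((x 0 ^ j₁ * x 1 ^ j₂ : ℝ) : ℂ) * FBP.kernel W 1 x = 0)
    (hKα : Integrable (fun x : FBP.Plane => ‖x‖ ^ α * ‖FBP.kernel W 1 x‖) volume)
    (L : ℝ) (hL : 0 < L) :
    MemLp (fun x => (f x : ℂ) - FBP.fbp W L f x) p volume ∧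
      eLpNorm (fun x => (f x : ℂ) - FBP.fbp W L f x) p volume ≤
        ENNReal.ofReal
          (FBP.besovConst θ q * (Real.Gamma (θ + 1) / Real.Gamma (α + 1)) *
            (∫ x : FBP.Plane, ‖x‖ ^ α * ‖FBP.kernel W 1 x‖) * L ^ (-α)) *
          FBP.besovSeminorm n θ p q f := by
  subst hα
  exact mainTheorem2_general n θ hθ0 p q hp (one_pos.trans_le hq).ne' f
    (memLp_one_iff_integrable.1 hf1) hf.2 W hW0 hWcont (memLp_one_iff_integrable.1 hA1) hK hmom hKα
    L hL
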